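/- Let $N \ge 2$ and let $\partial\mathbb{H}^N = \mathbb{R}^{N-1}\cup\{\infty\}$ be the boundary of the upper half-space model of hyperbolic space. A conformal map of $\partial\mathbb{H}^N$ means a Möbius transformation, i.e. the boundary map of an isometry of $\mathbb{H}^N$ (orientation reversing ones included). For $\epsilon \ne M$ in $\partial\mathbb{H}^N$ and $A \in GL_{N-1}(\mathbb{R})$, a *linear map based at $\epsilon, M$ with multiplier $A$* is a map $S A S^{-1}$ of $\partial\mathbb{H}^N$, where $A$ is extended by $A(\infty)=\infty$ and $S$ is a conformal map with $S(0)=\epsilon$, $S(\infty)=M$, $DS(0)=I$ (if $\epsilon=\infty$ the derivative is taken in the chart $x\mapsto x/\|x\|^2$ at $\infty$). Let $G$ be a cocompact Kleinian group, i.e. a discrete group of isometries of $\mathbb{H}^N$ acting cocompactly on $\mathbb{H}^N$, and for $n \in \mathbb{N}$ let $F_n$ be a linear map based at $\epsilon_n, M_n$ with multiplier $A_n$. Suppose that each of the sequences $(\epsilon_n)$ and $(M_n)$ takes infinitely many distinct values, that $\epsilon_n \to \epsilon$ and $M_n \to M$ in $\partial\mathbb{H}^N$ with $\epsilon \neq M$,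 and that $A_n$ converges to an invertible linear map $A$ with Euclidean operator norm $\|A\|<1$. Then the closure $\hat G=\overline{\langle G,\{F_n\}\rangle}$, in the group of homeomorphisms of $\partial\mathbb{H}^N$ with the uniform topology, of the group generated by (the boundary maps of) $G$ and all the $F_n$ contains a non-trivial one-parameter subgroup, i.e. there is a continuous homomorphism $t\mapsto f_t$ from $\mathbb{R}$ to $\mathrm{Homeo}(\partial\mathbb{H}^N)$ with $f_t\in\hat G$ for all $t$ and $f_t \neq \mathrm{id}$ for some $t$. -/

import Mathlib

open Filter Topology
open scoped OnePoint

noncomputable section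

namespace KleinianFlow

/-- Euclidean space `ℝ^d`; hyperbolic space has dimension `N = d + 1`. -/
abbrev E (d : ℕ) : Type := EuclideanSpace ℝ (Fin d)

/-- The upper half-space `ℍ^(d+1) = {(x, t) | x ∈ ℝ^d, t > 0}`, with its usual topology. -/
abbrev HypSpace (d : ℕ) : Type := {p : E d × ℝ // 0 < p.2}

/-- The boundary `∂ℍ^(d+1) = ℝ^d ∪ {∞}`. -/
abbrev Bdry (d : ℕ) : Type := OnePoint (E d)

/-- The hyperbolic distance on the upper half-space:
`2 arsinh (‖p - q‖ / (2 √(t s)))` for `p = (x, t)`, `q = (y, s)`, where `‖p - q‖` is the Euclidean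
distance in `ℝ^(d+1)`. -/
def hdist {d : ℕ} (p q : HypSpace d) : ℝ :=
  2 * Real.arsinh (√(‖p.1.1 - q.1.1‖ ^ 2 + (p.1.2 - q.1.2) ^ 2) / (2 * √(p.1.2 * q.1.2)))

/-- The full isometry group of `ℍ^(d+1)` (orientation reversing isometries included). -/
def hypIsom (d : ℕ) : Subgroup (Equiv.Perm (HypSpace d)) where
  carrier := {g | ∀ p q, hdist (g p) (g q) = hdist p q}
  mul_mem' := by
    intro a b ha hb p q
    rw [Equiv.Perm.mul_apply, Equiv.Perm.mul_apply, ha, hb]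
  one_mem' := fun _ _ => rfl
  inv_mem' := by
    intro a ha p q
    have h := ha (a⁻¹ p) (a⁻¹ q)
    simp only [← Equiv.Perm.mul_apply, mul_inv_cancel, Equiv.Perm.one_apply] at h
    exact h.symm

/-- `ℍ^(d+1)` and `∂ℍ^(d+1)` inside the one-point compactification of `ℝ^d × ℝ`; the union of the
two images is the closed hyperbolic ball `ℍ^(d+1) ∪ ∂ℍ^(d+1)`. -/
def inclHyp {d : ℕ} (p : HypSpace d) : OnePoint (E d × ℝ) := ((p.1 : E d × ℝ) : OnePoint (E d × ℝ))

/-- See `inclHyp`: a finite boundary point `x` is sent to `(x, 0)`, and `∞` to `∞`. -/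
def inclBdry {d : ℕ} (ξ : Bdry d) : OnePoint (E d × ℝ) := OnePoint.map (fun x => (x, (0 : ℝ))) ξ

/-- `φ` is the boundary map of `g`: whenever `p ∈ ℍ^(d+1)` tends to a boundary point `ξ`,
the image `g p` tends to `φ ξ`. -/
def IsBoundaryMap {d : ℕ} (g : Equiv.Perm (HypSpace d)) (φ : Bdry d ≃ₜ Bdry d) : Prop :=
  ∀ ξ : Bdry d,
    Tendsto (fun p : HypSpace d => inclHyp (g p)) (comap inclHyp (𝓝 (inclBdry ξ)))
      (𝓝 (inclBdry (φ ξ)))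

/-- Conformal maps of `∂ℍ^(d+1) = ℝ^d ∪ {∞}`, i.e. Möbius transformations: the boundary maps of
isometries of `ℍ^(d+1)`. -/
def IsConformal {d : ℕ} (S : Bdry d ≃ₜ Bdry d) : Prop :=
  ∃ g ∈ hypIsom d, IsBoundaryMap g S

/-- A cocompact Kleinian group: a discrete group of isometries of `ℍ^(d+1)` acting cocompactly.
On the isometry group the Lie group topology is the topology of pointwise convergence, that is the
topology of the product `ℍ^(d+1) → ℍ^(d+1)`. -/
structure IsCocompactKleinian {d : ℕ} (G : Subgroup (Equiv.Perm (HypSpace d))) : Prop where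
  isometries : G ≤ hypIsom d
  discrete : IsDiscrete ((fun g : Equiv.Perm (HypSpace d) => (g : HypSpace d → HypSpace d)) ''
    (G : Set (Equiv.Perm (HypSpace d))))
  cocompact : ∃ K : Set (HypSpace d), IsCompact K ∧ ∀ p, ∃ g ∈ G, g p ∈ K

/-- The group `G` of isometries seen as a set of homeomorphisms of the boundary. -/
def boundaryMaps {d : ℕ} (G : Subgroup (Equiv.Perm (HypSpace d))) : Set (Bdry d ≃ₜ Bdry d) :=
  {φ | ∃ g ∈ G, IsBoundaryMap g φ}

/-- The uniform topology on `Homeo(∂ℍ^(d+1))`. As `∂ℍ^(d+1)` is compact, uniform convergence is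
convergence in the compact-open topology of continuous maps. -/
instance homeoTopology (d : ℕ) : TopologicalSpace (Bdry d ≃ₜ Bdry d) :=
  TopologicalSpace.induced (fun f => (f : C(Bdry d, Bdry d))) inferInstance

/-- An invertible linear map of `ℝ^d`, extended to `ℝ^d ∪ {∞}` by `∞ ↦ ∞`. -/
def linExt {d : ℕ} (A : E d ≃L[ℝ] E d) : Bdry d ≃ₜ Bdry d := A.toHomeomorph.onePointCongr

/-- The chart of `ℝ^d ∪ {∞}` in which derivatives at a point `p` are taken: the identity of `ℝ^d` if
`p` is finite, and the inversion `y ↦ y / ‖y‖²`, `∞ ↦ 0` if `p = ∞`. (The value at the one point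
outside of the chart is irrelevant.) -/
def bdryChart {d : ℕ} (p : Bdry d) : Bdry d → E d :=
  p.elim (fun z => z.elim 0 (fun y => (‖y‖ ^ 2)⁻¹ • y)) (fun _ z => z.elim 0 id)

/-- `g` is a linear map based at `ε, M` with multiplier `A`: it is the conjugate of `A` by a
conformal map `S` with `S 0 = ε`, `S ∞ = M` and `DS(0) = I` (so that `ε ≠ M`). -/
def IsBasedLinearMap {d : ℕ} (ε M : Bdry d) (A : E d ≃L[ℝ] E d) (g : Bdry d ≃ₜ Bdry d) : Prop :=
  ∃ S : Bdry d ≃ₜ Bdry d, IsConformal S ∧ S ((0 : E d) : Bdry d) = ε ∧ S ∞ = M ∧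
    HasFDerivAt (fun x : E d => bdryChart ε (S (x : Bdry d))) (ContinuousLinearMap.id ℝ (E d)) 0 ∧
    g = S * linExt A * S⁻¹

/-- A set of homeomorphisms of the boundary contains a non-trivial (continuous) one-parameter
subgroup. -/
def ContainsOneParameterSubgroup {d : ℕ} (H : Set (Bdry d ≃ₜ Bdry d)) : Prop :=
  ∃ f : ℝ → (Bdry d ≃ₜ Bdry d), Continuous f ∧ (∀ s t, f (s + t) = f s * f t) ∧
    (∃ t, f t ≠ 1) ∧ ∀ t, f t ∈ H

end KleinianFlow

end

noncomputable section

namespace KleinianFlow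

variable {d : ℕ} {ι : Type*} {l : Filter ι}

theorem tendsto_homeo_iff {f : ι → (Bdry d ≃ₜ Bdry d)} {g : Bdry d ≃ₜ Bdry d} :
    Tendsto f l (𝓝 g) ↔
      ∀ ξ, Tendsto (fun q : ι × Bdry d => f q.1 q.2) (l ×ˢ 𝓝 ξ) (𝓝 (g ξ)) := by
  have hind : IsInducing (fun f : Bdry d ≃ₜ Bdry d => (f : C(Bdry d, Bdry d))) := ⟨rfl⟩
  rw [hind.tendsto_nhds_iff]
  constructor
  · intro h ξ
    have h1 : Tendsto (fun q : C(Bdry d, Bdry d) × Bdry d => q.1 q.2)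
        (𝓝 ((g : C(Bdry d, Bdry d)), ξ)) (𝓝 (g ξ)) :=
      (ContinuousEval.continuous_eval (F := C(Bdry d, Bdry d))).tendsto _
    have h2 := (h.comp tendsto_fst).prodMk_nhds (tendsto_snd (f := l) (g := 𝓝 ξ))
    exact h1.comp h2
  · intro h
    rw [ContinuousMap.tendsto_nhds_compactOpen]
    intro K hK U hU hmaps
    have h1 : ∀ ξ ∈ K, ∀ᶠ q : ι × Bdry d in l ×ˢ 𝓝 ξ, f q.1 q.2 ∈ U := fun ξ hξ =>
      (h ξ).eventually (hU.mem_nhds (hmaps hξ))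
    have h2 : ∀ᶠ q : ι × Bdry d in l ×ˢ 𝓝ˢ K, f q.1 q.2 ∈ U := by
      rw [hK.prod_nhdsSet_eq_biSup, eventually_iSup]
      intro ξ
      rw [eventually_iSup]
      exact h1 ξ
    exact (h2.curry.mono fun a ha ξ hξ => (ha.self_of_nhdsSet ξ hξ))

theorem homeo_tendsto_apply {f : ι → (Bdry d ≃ₜ Bdry d)} {g : Bdry d ≃ₜ Bdry d}
    (h : Tendsto f l (𝓝 g)) (ξ : Bdry d) : Tendsto (fun i => f i ξ) l (𝓝 (g ξ)) :=
  (tendsto_homeo_iff.1 h ξ).comp (tendsto_id.prodMk tendsto_const_nhds)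

theorem homeo_tendsto_inv {f : ι → (Bdry d ≃ₜ Bdry d)} {g : Bdry d ≃ₜ Bdry d}
    (h : Tendsto f l (𝓝 g)) : Tendsto (fun i => (f i)⁻¹) l (𝓝 g⁻¹) := by
  rw [tendsto_homeo_iff] at h ⊢
  intro ξ
  refine le_nhds_of_unique_clusterPt (fun η hη => ?_)
  have hη' : MapClusterPt η (l ×ˢ 𝓝 ξ) (fun q : ι × Bdry d => (f q.1)⁻¹ q.2) := hη
  rw [mapClusterPt_iff_ultrafilter] at hη'
  obtain ⟨U, hU, hUη⟩ := hη'
  have h1 : Tendsto (fun q : ι × Bdry d => q.1) U l := tendsto_fst.mono_left hU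
  have h2 : Tendsto (fun q : ι × Bdry d => q.2) U (𝓝 ξ) := tendsto_snd.mono_left hU
  have h3 := (h η).comp (h1.prodMk hUη)
  have h4 : Tendsto (fun q : ι × Bdry d => q.2) U (𝓝 (g η)) := by
    refine h3.congr fun q => ?_
    exact (f q.1).apply_symm_apply q.2
  have h5 := tendsto_nhds_unique h2 h4
  rw [h5]
  exact (g.symm_apply_apply η).symm

theorem homeo_tendsto_mul {f f' : ι → (Bdry d ≃ₜ Bdry d)} {g g' : Bdry d ≃ₜ Bdry d}
    (h : Tendsto f l (𝓝 g)) (h' : Tendsto f' l (𝓝 g')) :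
    Tendsto (fun i => f i * f' i) l (𝓝 (g * g')) := by
  rw [tendsto_homeo_iff] at h h' ⊢
  intro ξ
  exact (h (g' ξ)).comp (tendsto_fst.prodMk (h' ξ))

instance : IsTopologicalGroup (Bdry d ≃ₜ Bdry d) where
  continuous_mul := continuous_iff_continuousAt.2 fun _ =>
    homeo_tendsto_mul continuousAt_fst continuousAt_snd
  continuous_inv := continuous_iff_continuousAt.2 fun _ => homeo_tendsto_inv tendsto_id

theorem tendsto_onePointCongr {f : ι → (Bdry d ≃ₜ Bdry d)} {e : E d ≃ₜ E d}
    (h : ∀ x : E d, Tendsto (fun q : ι × E d => f q.1 (q.2 : Bdry d)) (l ×ˢ 𝓝 x)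
      (𝓝 ((e x : E d) : Bdry d)))
    (h' : ∀ x : E d, Tendsto (fun q : ι × E d => (f q.1)⁻¹ (q.2 : Bdry d)) (l ×ˢ 𝓝 x)
      (𝓝 ((e.symm x : E d) : Bdry d))) :
    Tendsto f l (𝓝 e.onePointCongr) := by
  have key : ∀ {k : ι → Bdry d → Bdry d} {u : E d → E d}, (∀ x : E d,
      Tendsto (fun q : ι × E d => k q.1 (q.2 : Bdry d)) (l ×ˢ 𝓝 x) (𝓝 ((u x : E d) : Bdry d))) →
      ∀ x : E d, Tendsto (fun q : ι × Bdry d => k q.1 q.2) (l ×ˢ 𝓝 (x : Bdry d))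
        (𝓝 ((u x : E d) : Bdry d)) := by
    intro k u hk x
    rw [OnePoint.nhds_coe_eq, ← Filter.map_id (f := l), Filter.prod_map_map_eq, tendsto_map'_iff]
    exact hk x
  rw [tendsto_homeo_iff]
  intro ξ
  induction ξ using OnePoint.rec with
  | coe x => exact key (k := fun i => f i) h x
  | infty =>
    refine le_nhds_of_unique_clusterPt (fun η hη => ?_)
    have hη' : MapClusterPt η (l ×ˢ 𝓝 ∞) (fun q : ι × Bdry d => f q.1 q.2) := hη
    rw [mapClusterPt_iff_ultrafilter] at hη'
    obtain ⟨U, hU, hUη⟩ := hη'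
    have h1 : Tendsto (fun q : ι × Bdry d => q.1) U l := tendsto_fst.mono_left hU
    have h2 : Tendsto (fun q : ι × Bdry d => q.2) U (𝓝 ∞) := tendsto_snd.mono_left hU
    induction η using OnePoint.rec with
    | infty => rfl
    | coe y =>
      exfalso
      have h3 := (key (k := fun i => ⇑(f i)⁻¹) h' y).comp (h1.prodMk hUη)
      have h4 : Tendsto (fun q : ι × Bdry d => q.2) U (𝓝 ((e.symm y : E d) : Bdry d)) := by
        refine h3.congr fun q => ?_
        exact (f q.1).symm_apply_apply q.2
      exact OnePoint.infty_ne_coe _ (tendsto_nhds_unique h2 h4)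

/-- The translation by `v`, extended to the boundary. -/
def translation (v : E d) : Bdry d ≃ₜ Bdry d := (Homeomorph.addRight v).onePointCongr

@[simp] theorem translation_coe (v x : E d) : translation v (x : Bdry d) = ((x + v : E d) : Bdry d) :=
  rfl

theorem translation_add (v w : E d) : translation (v + w) = translation v * translation w := by
  ext ξ
  induction ξ using OnePoint.rec with
  | infty => rfl
  | coe x => exact congrArg OnePoint.some (by abel : x + (v + w) = x + w + v)

theorem translation_zero : translation (0 : E d) = 1 := by
  ext ξ
  induction ξ using OnePoint.rec with
  | infty => rfl
  | coe x => exact congrArg OnePoint.some (add_zero x)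

theorem translation_neg (v : E d) : translation (-v) = (translation v)⁻¹ := by
  rw [eq_inv_iff_mul_eq_one, ← translation_add, neg_add_cancel, translation_zero]

theorem continuous_translation : Continuous (translation : E d → (Bdry d ≃ₜ Bdry d)) := by
  rw [continuous_iff_continuousAt]
  intro v
  refine tendsto_onePointCongr (fun x => ?_) (fun x => ?_)
  · have : Continuous (fun q : E d × E d => ((q.2 + q.1 : E d) : Bdry d)) :=
      OnePoint.continuous_coe.comp (by fun_prop)
    rw [← nhds_prod_eq]; exact this.tendsto (v, x)
  · have : Continuous (fun q : E d × E d => ((q.2 + -q.1 : E d) : Bdry d)) :=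
      OnePoint.continuous_coe.comp (by fun_prop)
    rw [← nhds_prod_eq]; exact this.tendsto (v, x)

@[simp] theorem linExt_coe (A : E d ≃L[ℝ] E d) (x : E d) :
    linExt A (x : Bdry d) = ((A x : E d) : Bdry d) := rfl

theorem linExt_inv_coe (A : E d ≃L[ℝ] E d) (x : E d) :
    (linExt A)⁻¹ (x : Bdry d) = ((A.symm x : E d) : Bdry d) := rfl

theorem tendsto_symm_of_tendsto {A : ι → (E d ≃L[ℝ] E d)} {B : E d ≃L[ℝ] E d}
    (h : Tendsto (fun i => (A i : E d →L[ℝ] E d)) l (𝓝 (B : E d →L[ℝ] E d))) :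
    Tendsto (fun i => ((A i).symm : E d →L[ℝ] E d)) l (𝓝 (B.symm : E d →L[ℝ] E d)) := by
  have h1 : ContinuousAt ContinuousLinearMap.inverse (B : E d →L[ℝ] E d) :=
    (contDiffAt_map_inverse (n := 0) (𝕜 := ℝ) B).continuousAt
  have h2 := h1.tendsto.comp h
  simpa [Function.comp_def] using h2

theorem tendsto_linExt {A : ι → (E d ≃L[ℝ] E d)} {B : E d ≃L[ℝ] E d}
    (h : Tendsto (fun i => (A i : E d →L[ℝ] E d)) l (𝓝 (B : E d →L[ℝ] E d))) :
    Tendsto (fun i => linExt (A i)) l (𝓝 (linExt B)) := by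
  have key : ∀ {C : ι → (E d →L[ℝ] E d)} {D : E d →L[ℝ] E d}, Tendsto C l (𝓝 D) → ∀ x : E d,
      Tendsto (fun q : ι × E d => ((C q.1 q.2 : E d) : Bdry d)) (l ×ˢ 𝓝 x)
        (𝓝 ((D x : E d) : Bdry d)) := by
    intro C D hC x
    have h1 : Continuous (fun q : (E d →L[ℝ] E d) × E d => ((q.1 q.2 : E d) : Bdry d)) :=
      OnePoint.continuous_coe.comp (by fun_prop)
    exact (h1.tendsto (D, x)).comp
      ((hC.comp tendsto_fst).prodMk_nhds (tendsto_snd (f := l) (g := 𝓝 x)))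
  refine tendsto_onePointCongr (fun x => ?_) (fun x => ?_)
  · exact key h x
  · exact key (tendsto_symm_of_tendsto h) x

/-- The space `ℝ^d × ℝ × ℝ`, carrying a Lorentz form, in which hyperbolic isometries are linear. -/
abbrev Lor (d : ℕ) : Type := E d × ℝ × ℝ

/-- The Lorentz form on `Lor d`. -/
def lor : Lor d →ₗ[ℝ] Lor d →ₗ[ℝ] ℝ :=
  LinearMap.mk₂ ℝ (fun a b => a.2.1 * b.2.2 + a.2.2 * b.2.1 - 2 * inner ℝ a.1 b.1)
    (by intro a b c; simp [inner_add_left]; ring)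
    (by intro r a b; simp [inner_smul_left]; ring)
    (by intro a b c; simp [inner_add_right]; ring)
    (by intro r a b; simp [inner_smul_right]; ring)

theorem lor_apply (a b : Lor d) :
    lor a b = a.2.1 * b.2.2 + a.2.2 * b.2.1 - 2 * inner ℝ a.1 b.1 := rfl

theorem lor_self (a : Lor d) : lor a a = 2 * (a.2.1 * a.2.2 - ‖a.1‖ ^ 2) := by
  rw [lor_apply, real_inner_self_eq_norm_sq]; ring

/-- The point of the hyperboloid corresponding to a point of the upper half-space. -/
def hypPt (p : HypSpace d) : Lor d :=
  ((p.1.2)⁻¹ • p.1.1, (‖p.1.1‖ ^ 2 + p.1.2 ^ 2) / p.1.2, (p.1.2)⁻¹)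

theorem lor_hypPt (p q : HypSpace d) : lor (hypPt p) (hypPt q) =
    2 + (‖p.1.1 - q.1.1‖ ^ 2 + (p.1.2 - q.1.2) ^ 2) / (p.1.2 * q.1.2) := by
  have hp := p.2.ne'
  have hq := q.2.ne'
  rw [lor_apply, @norm_sub_sq_real]
  simp only [hypPt, inner_smul_left, inner_smul_right, RCLike.conj_to_real]
  field_simp
  ring

theorem two_le_lor_hypPt (p q : HypSpace d) : 2 ≤ lor (hypPt p) (hypPt q) := by
  have hp := p.2
  have hq := q.2
  rw [lor_hypPt, le_add_iff_nonneg_right]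
  positivity

theorem hdist_eq (p q : HypSpace d) :
    hdist p q = 2 * Real.arsinh (√(lor (hypPt p) (hypPt q) - 2) / 2) := by
  have hp := p.2
  have hq := q.2
  rw [lor_hypPt, add_sub_cancel_left, Real.sqrt_div (by positivity), hdist]
  congr 2
  field_simp

theorem hdist_eq_hdist_iff {p q p' q' : HypSpace d} : hdist p q = hdist p' q' ↔
    lor (hypPt p) (hypPt q) = lor (hypPt p') (hypPt q') := by
  constructor
  · intro h
    rw [hdist_eq, hdist_eq, mul_right_inj' two_ne_zero, Real.arsinh_inj,
      div_left_inj' two_ne_zero, Real.sqrt_inj (by linarith [two_le_lor_hypPt p q])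
      (by linarith [two_le_lor_hypPt p' q'])] at h
    linarith
  · intro h
    rw [hdist_eq, hdist_eq, h]

/-- The point `(x, t)` of the upper half-space. -/
def mkPt (x : E d) (t : ℝ) (ht : 0 < t) : HypSpace d := ⟨(x, t), ht⟩

theorem span_hypPt : Submodule.span ℝ (Set.range (hypPt (d := d))) = ⊤ := by
  have mem : ∀ (x : E d) (t : ℝ), 0 < t →
      ((t⁻¹ • x, (‖x‖ ^ 2 + t ^ 2) / t, t⁻¹) : Lor d) ∈
        Submodule.span ℝ (Set.range (hypPt (d := d))) := fun x t ht =>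
    Submodule.subset_span ⟨mkPt x t ht, rfl⟩
  rw [eq_top_iff]
  rintro ⟨u, w, σ⟩ -
  have h1 := mem 0 1 one_pos
  have h2 := mem 0 2 two_pos
  have h3 := mem u 1 one_pos
  have e : ((u, w, σ) : Lor d) = (1 : ℝ) • ((1:ℝ)⁻¹ • u, (‖u‖ ^ 2 + 1 ^ 2) / 1, (1:ℝ)⁻¹)
      + ((4 * (σ - 1) - (w - ‖u‖ ^ 2 - 1)) / 3) •
        ((1:ℝ)⁻¹ • (0 : E d), (‖(0 : E d)‖ ^ 2 + 1 ^ 2) / 1, (1:ℝ)⁻¹)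
      + ((2 * (w - ‖u‖ ^ 2 - 1) - 2 * (σ - 1)) / 3) •
        ((2:ℝ)⁻¹ • (0 : E d), (‖(0 : E d)‖ ^ 2 + 2 ^ 2) / 2, (2:ℝ)⁻¹) := by
    ext i
    · simp
    · simp; ring
    · simp; ring
  rw [e]
  exact Submodule.add_mem _ (Submodule.add_mem _ (Submodule.smul_mem _ _ h3)
    (Submodule.smul_mem _ _ h1)) (Submodule.smul_mem _ _ h2)

theorem eq_of_lor_hypPt {a b : Lor d} (h : ∀ p, lor a (hypPt p) = lor b (hypPt p)) : a = b := by
  have h1 : lor a = lor b := by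
    refine LinearMap.ext_on_range span_hypPt ?_
    exact h
  have h2 : lor (a - b) = 0 := by rw [map_sub, h1, sub_self]
  have e : a - b = 0 := by
    have c1 : (a - b).2.2 = 0 := by
      have := LinearMap.congr_fun h2 ((0, 1, 0) : Lor d)
      simpa [lor_apply] using this
    have c2 : (a - b).2.1 = 0 := by
      have := LinearMap.congr_fun h2 ((0, 0, 1) : Lor d)
      simpa [lor_apply] using this
    have c3 : (a - b).1 = 0 := by
      have := LinearMap.congr_fun h2 (((a - b).1, 0, 0) : Lor d)
      rw [lor_apply, real_inner_self_eq_norm_sq] at this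
      simpa using this
    exact Prod.ext c3 (Prod.ext c2 c1)
  exact sub_eq_zero.1 e

/-- The linear map `T` extends the isometry `g` from the hyperboloid. -/
def Represents (T : Lor d →L[ℝ] Lor d) (g : Equiv.Perm (HypSpace d)) : Prop :=
  ∀ p, T (hypPt p) = hypPt (g p)

theorem exists_represents {g : Equiv.Perm (HypSpace d)} (hg : g ∈ hypIsom d) :
    ∃ T, Represents T g := by
  have hsurj : Function.Surjective (Finsupp.linearCombination ℝ (hypPt (d := d))) := by
    rw [← LinearMap.range_eq_top, Finsupp.range_linearCombination, span_hypPt]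
  obtain ⟨ρ, hρ⟩ := LinearMap.exists_rightInverse_of_surjective _ (LinearMap.range_eq_top.2 hsurj)
  let T : Lor d →ₗ[ℝ] Lor d := (Finsupp.linearCombination ℝ (fun p => hypPt (g p))).comp ρ
  refine ⟨T.toContinuousLinearMap, fun p => eq_of_lor_hypPt fun q' => ?_⟩
  obtain ⟨q, rfl⟩ := g.surjective q'
  have key : ∀ c : HypSpace d →₀ ℝ,
      lor (Finsupp.linearCombination ℝ (fun p => hypPt (g p)) c) (hypPt (g q)) =
        lor (Finsupp.linearCombination ℝ hypPt c) (hypPt q) := by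
    intro c
    have h1 : ∀ r, lor (hypPt (g r)) (hypPt (g q)) = lor (hypPt r) (hypPt q) := fun r =>
      hdist_eq_hdist_iff.1 (hg r q)
    simp only [Finsupp.linearCombination_apply, Finsupp.sum, map_sum, LinearMap.sum_apply,
      map_smul, LinearMap.smul_apply, h1]
  have h2 : Finsupp.linearCombination ℝ hypPt (ρ (hypPt p)) = hypPt p :=
    LinearMap.congr_fun hρ _
  have h3 : T.toContinuousLinearMap (hypPt p) =
      Finsupp.linearCombination ℝ (fun p => hypPt (g p)) (ρ (hypPt p)) := rfl
  rw [h3, key, h2]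
  exact (hdist_eq_hdist_iff.1 (hg p q)).symm

theorem clm_ext_hypPt {T T' : Lor d →L[ℝ] Lor d} (h : ∀ p, T (hypPt p) = T' (hypPt p)) : T = T' :=
  ContinuousLinearMap.coe_injective (LinearMap.ext_on_range span_hypPt h)

theorem Represents.mul {T T' : Lor d →L[ℝ] Lor d} {g g' : Equiv.Perm (HypSpace d)}
    (h : Represents T g) (h' : Represents T' g') : Represents (T * T') (g * g') := fun p => by
  rw [mul_apply_eq_comp, h', h, Equiv.Perm.mul_apply]

theorem Represents.unique {T T' : Lor d →L[ℝ] Lor d} {g : Equiv.Perm (HypSpace d)}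
    (h : Represents T g) (h' : Represents T' g) : T = T' :=
  clm_ext_hypPt fun p => by rw [h, h']

theorem represents_one : Represents (1 : Lor d →L[ℝ] Lor d) 1 := fun _ => rfl

theorem Represents.mul_eq_one {T T' : Lor d →L[ℝ] Lor d} {g : Equiv.Perm (HypSpace d)}
    (h : Represents T g) (h' : Represents T' g⁻¹) : T * T' = 1 := by
  have := h.mul h'
  rw [mul_inv_cancel] at this
  exact this.unique represents_one

theorem Represents.mul_eq_one' {T T' : Lor d →L[ℝ] Lor d} {g : Equiv.Perm (HypSpace d)}
    (h : Represents T g) (h' : Represents T' g⁻¹) : T' * T = 1 := by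
  have := h'.mul h
  rw [inv_mul_cancel] at this
  exact this.unique represents_one

theorem Represents.lor_eq {T : Lor d →L[ℝ] Lor d} {g : Equiv.Perm (HypSpace d)}
    (h : Represents T g) (hg : g ∈ hypIsom d) (a b : Lor d) : lor (T a) (T b) = lor a b := by
  have h1 : (lor.compl₁₂ (T : Lor d →ₗ[ℝ] Lor d) (T : Lor d →ₗ[ℝ] Lor d)) = lor := by
    refine LinearMap.ext_on_range span_hypPt fun p => ?_
    refine LinearMap.ext_on_range span_hypPt fun q => ?_
    simp only [LinearMap.compl₁₂_apply, ContinuousLinearMap.coe_coe, h p, h q]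
    exact hdist_eq_hdist_iff.1 (hg p q)
  exact LinearMap.congr_fun (LinearMap.congr_fun h1 a) b

/-- The sum of the two light cone coordinates. -/
def lorMass : Lor d →L[ℝ] ℝ :=
  (ContinuousLinearMap.fst ℝ ℝ ℝ + ContinuousLinearMap.snd ℝ ℝ ℝ).comp
    (ContinuousLinearMap.snd ℝ (E d) (ℝ × ℝ))

theorem lorMass_apply (a : Lor d) : lorMass a = a.2.1 + a.2.2 := rfl

theorem lorMass_hypPt_pos (p : HypSpace d) : 0 < lorMass (hypPt p) := by
  have hp := p.2
  simp only [lorMass_apply, hypPt]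
  positivity

/-- The base point of the upper half-space. -/
def basePt (d : ℕ) : HypSpace d := mkPt 0 1 one_pos

theorem lor_basePt (a : Lor d) : lor a (hypPt (basePt d)) = lorMass a := by
  simp [lor_apply, lorMass_apply, hypPt, basePt, mkPt]

/-- The weight `1 + ‖x‖² + t²` of a point of `ℝ^d × ℝ`. -/
def weight (q : E d × ℝ) : ℝ := 1 + ‖q.1‖ ^ 2 + q.2 ^ 2

theorem weight_pos (q : E d × ℝ) : 0 < weight q := by unfold weight; positivity

theorem continuous_weight : Continuous (weight (d := d)) := by unfold weight; fun_prop

theorem tendsto_weight : Tendsto (weight (d := d)) (cocompact (E d × ℝ)) atTop := by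
  have h := tendsto_norm_cocompact_atTop (E := E d × ℝ)
  refine tendsto_atTop_mono (fun q => ?_) h
  have h1 : ‖q‖ = max ‖q.1‖ |q.2| := rfl
  rw [h1, max_le_iff, weight]
  constructor
  · nlinarith [sq_nonneg (‖q.1‖ - 1), sq_nonneg q.2]
  · nlinarith [sq_nonneg (|q.2| - 1), sq_nonneg ‖q.1‖, sq_abs q.2]

/-- The normalised ray of the light cone or hyperboloid belonging to a point. -/
def ray (z : OnePoint (E d × ℝ)) : Lor d :=
  z.elim (0, 1, 0) fun q => (weight q)⁻¹ • (q.1, ‖q.1‖ ^ 2 + q.2 ^ 2, 1)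

theorem ray_infty : ray (∞ : OnePoint (E d × ℝ)) = (0, 1, 0) := rfl

theorem ray_coe (q : E d × ℝ) :
    ray (q : OnePoint (E d × ℝ)) = (weight q)⁻¹ • (q.1, ‖q.1‖ ^ 2 + q.2 ^ 2, 1) := rfl

theorem continuous_ray : Continuous (ray (d := d)) := by
  rw [OnePoint.continuous_iff]
  constructor
  · rw [coclosedCompact_eq_cocompact]
    have h0 : Tendsto (fun q : E d × ℝ => (weight q)⁻¹) (cocompact (E d × ℝ)) (𝓝 0) :=
      tendsto_weight.inv_tendsto_atTop
    have h1 : Tendsto (fun q : E d × ℝ => (weight q)⁻¹ • q.1) (cocompact (E d × ℝ)) (𝓝 0) := by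
      rw [tendsto_zero_iff_norm_tendsto_zero]
      have h2 : Tendsto (fun q : E d × ℝ => √(weight q)⁻¹) (cocompact (E d × ℝ)) (𝓝 0) := by
        simpa using h0.sqrt
      refine squeeze_zero (fun _ => norm_nonneg _) (fun q => ?_) h2
      refine Real.le_sqrt_of_sq_le ?_
      have hw := weight_pos q
      rw [norm_smul, norm_inv, Real.norm_of_nonneg hw.le, mul_pow, sq (weight q)⁻¹, mul_assoc]
      refine mul_le_of_le_one_right (by positivity) ?_
      rw [inv_mul_le_iff₀ hw, weight]
      nlinarith [sq_nonneg q.2]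
    have h3 : Tendsto (fun q : E d × ℝ => (weight q)⁻¹ * (‖q.1‖ ^ 2 + q.2 ^ 2))
        (cocompact (E d × ℝ)) (𝓝 1) := by
      have h4 : Tendsto (fun q : E d × ℝ => 1 - (weight q)⁻¹) (cocompact (E d × ℝ)) (𝓝 1) := by
        simpa using h0.const_sub 1
      refine h4.congr fun q => ?_
      have hw := (weight_pos q).ne'
      field_simp
      simp only [weight]
      ring
    have h5 : Tendsto (fun q : E d × ℝ => (weight q)⁻¹ * 1) (cocompact (E d × ℝ)) (𝓝 0) := by
      simpa using h0
    exact h1.prodMk_nhds (h3.prodMk_nhds h5)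
  · have : Continuous fun q : E d × ℝ => (weight q)⁻¹ :=
      continuous_weight.inv₀ fun q => (weight_pos q).ne'
    simp only [ray_coe]
    fun_prop

theorem lorMass_ray (z : OnePoint (E d × ℝ)) : lorMass (ray z) = 1 := by
  induction z using OnePoint.rec with
  | infty => simp [ray_infty, lorMass_apply]
  | coe q =>
    rw [ray_coe, map_smul, lorMass_apply, smul_eq_mul, inv_mul_eq_one₀ (weight_pos q).ne', weight]
    ring

theorem hypPt_eq_smul_ray (p : HypSpace d) : hypPt p = lorMass (hypPt p) • ray (inclHyp p) := by
  have hp := p.2.ne'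
  have hw := (weight_pos p.1).ne'
  have e : lorMass (hypPt p) = weight p.1 / p.1.2 := by
    simp only [lorMass_apply, hypPt, weight]
    ring
  rw [e, inclHyp, ray_coe, smul_smul, div_mul_eq_mul_div, mul_inv_cancel₀ hw]
  ext1
  · simp [hypPt]
  · ext1
    · simp only [hypPt, Prod.smul_mk, smul_eq_mul]
      ring
    · simp [hypPt]

/-- The normalised light cone vector of a boundary point. -/
def bdryRay (ξ : Bdry d) : Lor d := ray (inclBdry ξ)

theorem continuous_inclBdry : Continuous (inclBdry (d := d)) := by
  refine OnePoint.continuous_map (by fun_prop) ?_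
  have hc : IsClosedEmbedding fun x : E d => (x, (0 : ℝ)) := by
    refine IsClosedEmbedding.of_continuous_injective_isClosedMap (by fun_prop)
      (fun x y h => (Prod.ext_iff.1 h).1) ?_
    exact isClosedMap_prodMk_right 0
  rw [coclosedCompact_eq_cocompact, coclosedCompact_eq_cocompact]
  exact hc.tendsto_cocompact

theorem continuous_bdryRay : Continuous (bdryRay (d := d)) :=
  continuous_ray.comp continuous_inclBdry

theorem bdryRay_infty : bdryRay (∞ : Bdry d) = (0, 1, 0) := rfl

theorem bdryRay_coe (x : E d) :
    bdryRay (x : Bdry d) = (1 + ‖x‖ ^ 2)⁻¹ • (x, ‖x‖ ^ 2, 1) := by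
  have : bdryRay (x : Bdry d) = (1 + ‖x‖ ^ 2 + 0 ^ 2)⁻¹ • (x, ‖x‖ ^ 2 + 0 ^ 2, 1) := rfl
  simpa using this

theorem lorMass_bdryRay (ξ : Bdry d) : lorMass (bdryRay ξ) = 1 := lorMass_ray _

/-- The forward light cone. -/
def lightCone (d : ℕ) : Set (Lor d) := {a | 0 ≤ a.2.1 ∧ 0 ≤ a.2.2 ∧ lor a a = 0}

theorem isClosed_lightCone : IsClosed (lightCone d) := by
  have h : Continuous fun a : Lor d => lor a a := by
    simp only [lor_self]; fun_prop
  have h1 : Continuous fun a : Lor d => a.2.1 := by fun_prop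
  have h2 : Continuous fun a : Lor d => a.2.2 := by fun_prop
  exact (isClosed_le continuous_const h1).inter
    ((isClosed_le continuous_const h2).inter (isClosed_eq h continuous_const))

theorem bdryRay_mem (ξ : Bdry d) : bdryRay ξ ∈ lightCone d := by
  induction ξ using OnePoint.rec with
  | infty => simp [bdryRay_infty, lightCone, lor_self]
  | coe x =>
    rw [bdryRay_coe]
    refine ⟨?_, ?_, ?_⟩
    · simp only [Prod.smul_mk, smul_eq_mul]; positivity
    · simp only [Prod.smul_mk, smul_eq_mul]; positivity
    · simp only [map_smul, LinearMap.smul_apply, lor_self]; simp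

theorem lorMass_nonneg {a : Lor d} (ha : a ∈ lightCone d) : 0 ≤ lorMass a :=
  add_nonneg ha.1 ha.2.1

theorem lorMass_pos {a : Lor d} (ha : a ∈ lightCone d) (h0 : a ≠ 0) : 0 < lorMass a := by
  refine (lorMass_nonneg ha).lt_of_ne fun h => h0 ?_
  obtain ⟨h1, h2, h3⟩ := ha
  rw [lorMass_apply] at h
  have e1 : a.2.1 = 0 := by linarith
  have e2 : a.2.2 = 0 := by linarith
  rw [lor_self, e1, e2] at h3
  have e3 : a.1 = 0 := by
    have : ‖a.1‖ ^ 2 = 0 := by linarith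
    simpa using this
  exact Prod.ext e3 (Prod.ext e1 e2)

theorem exists_eq_smul_bdryRay {a : Lor d} (ha : a ∈ lightCone d) (h0 : a ≠ 0) :
    ∃ ξ : Bdry d, a = lorMass a • bdryRay ξ := by
  have hm := lorMass_pos ha h0
  obtain ⟨h1, h2, h3⟩ := ha
  rw [lor_self] at h3
  rw [lorMass_apply] at hm ⊢
  rcases h2.eq_or_lt with h | h
  · refine ⟨∞, ?_⟩
    rw [← h] at h3 ⊢
    have e3 : a.1 = 0 := by
      have : ‖a.1‖ ^ 2 = 0 := by linarith
      simpa using this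
    rw [bdryRay_infty]
    ext1
    · simp [e3]
    · ext1
      · simp
      · simp [← h]
  · refine ⟨((a.2.2⁻¹ • a.1 : E d) : Bdry d), ?_⟩
    have e : ‖a.2.2⁻¹ • a.1‖ ^ 2 = a.2.1 / a.2.2 := by
      rw [norm_smul, mul_pow, norm_inv, Real.norm_of_nonneg h2]
      field_simp
      linarith
    have e' : (a.2.1 + a.2.2) * (1 + a.2.1 / a.2.2)⁻¹ = a.2.2 := by
      have : 1 + a.2.1 / a.2.2 = (a.2.1 + a.2.2) / a.2.2 := by field_simp; ring
      rw [this, inv_div]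
      field_simp
    rw [bdryRay_coe, smul_smul, e, e']
    ext1
    · simp [smul_smul, h.ne']
    · ext1
      · simp only [Prod.smul_mk, smul_eq_mul]; field_simp
      · simp

theorem bdryRay_injective : Function.Injective (bdryRay (d := d)) := by
  intro ξ η h
  induction ξ using OnePoint.rec with
  | infty =>
    induction η using OnePoint.rec with
    | infty => rfl
    | coe y =>
      have := congrArg (fun a : Lor d => a.2.2) h
      rw [bdryRay_infty, bdryRay_coe] at this
      have hy : 1 + ‖y‖ ^ 2 ≠ 0 := by positivity
      simp only [smul_eq_mul, Prod.smul_mk, mul_one] at this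
      exact absurd this.symm (inv_ne_zero hy)
  | coe x =>
    have hx : 1 + ‖x‖ ^ 2 ≠ 0 := by positivity
    induction η using OnePoint.rec with
    | infty =>
      have := congrArg (fun a : Lor d => a.2.2) h
      rw [bdryRay_infty, bdryRay_coe] at this
      simp [hx] at this
    | coe y =>
      have h2 := congrArg (fun a : Lor d => a.2.2) h
      have h1 := congrArg (fun a : Lor d => a.1) h
      simp only [bdryRay_coe, Prod.smul_mk, smul_eq_mul, mul_one] at h1 h2
      rw [h2] at h1
      have hy : (1 + ‖y‖ ^ 2)⁻¹ ≠ 0 := by positivity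
      rw [smul_right_injective _ hy h1]

theorem eq_of_smul_bdryRay_eq {ξ η : Bdry d} {r s : ℝ} (hr : r ≠ 0)
    (h : r • bdryRay ξ = s • bdryRay η) : ξ = η := by
  have := congrArg lorMass h
  simp only [map_smul, lorMass_bdryRay, smul_eq_mul, mul_one] at this
  subst this
  exact bdryRay_injective (smul_right_injective _ hr h)

theorem isClosedEmbedding_bdryRay : IsClosedEmbedding (bdryRay (d := d)) :=
  continuous_bdryRay.isClosedEmbedding bdryRay_injective

theorem lor_bdryRay_pos {ξ η : Bdry d} (h : ξ ≠ η) : 0 < lor (bdryRay ξ) (bdryRay η) := by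
  induction ξ using OnePoint.rec with
  | infty =>
    induction η using OnePoint.rec with
    | infty => exact absurd rfl h
    | coe y => simp only [bdryRay_infty, bdryRay_coe, lor_apply]; simp; positivity
  | coe x =>
    induction η using OnePoint.rec with
    | infty => simp only [bdryRay_infty, bdryRay_coe, lor_apply]; simp; positivity
    | coe y =>
      have hxy : x - y ≠ 0 := fun h' => h (by rw [sub_eq_zero.1 h'])
      have h1 : lor ((x, ‖x‖ ^ 2, 1) : Lor d) (y, ‖y‖ ^ 2, 1) = ‖x - y‖ ^ 2 := by
        rw [lor_apply, @norm_sub_sq_real]; simp; ring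
      rw [bdryRay_coe, bdryRay_coe, map_smul, map_smul, LinearMap.smul_apply, h1]
      have := norm_pos_iff.2 hxy
      simp only [smul_eq_mul]
      positivity

theorem inclBdry_injective : Function.Injective (inclBdry (d := d)) := fun _ _ h =>
  bdryRay_injective (congrArg ray h)

theorem inclBdry_mem_closure (ξ : Bdry d) :
    inclBdry ξ ∈ closure (Set.range (inclHyp (d := d))) := by
  induction ξ using OnePoint.rec with
  | infty =>
    have h : Tendsto (fun n : ℕ => ((0 : E d), (n : ℝ) + 1)) atTop (cocompact (E d × ℝ)) := by
      rw [← Metric.cobounded_eq_cocompact, ← tendsto_norm_atTop_iff_cobounded]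
      refine tendsto_atTop_mono (fun n => ?_) tendsto_natCast_atTop_atTop
      refine le_trans ?_ (norm_snd_le ((0 : E d), (n : ℝ) + 1))
      exact (le_add_of_nonneg_right zero_le_one).trans (le_abs_self _)
    refine mem_closure_of_tendsto (OnePoint.tendsto_coe_infty.comp
      (by rwa [coclosedCompact_eq_cocompact])) (Eventually.of_forall fun n => ?_)
    exact ⟨mkPt 0 ((n : ℝ) + 1) (by positivity), rfl⟩
  | coe x =>
    have h : Tendsto (fun n : ℕ => (x, 1 / ((n : ℝ) + 1))) atTop (𝓝 (x, (0 : ℝ))) :=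
      tendsto_const_nhds.prodMk_nhds tendsto_one_div_add_atTop_nhds_zero_nat
    refine mem_closure_of_tendsto ((OnePoint.continuous_coe.tendsto _).comp h)
      (Eventually.of_forall fun n => ?_)
    exact ⟨mkPt x (1 / ((n : ℝ) + 1)) (by positivity), rfl⟩

instance (ξ : Bdry d) : (comap (inclHyp (d := d)) (𝓝 (inclBdry ξ))).NeBot := by
  rw [comap_neBot_iff]
  intro t ht
  obtain ⟨_, h, p, rfl⟩ := mem_closure_iff_nhds.1 (inclBdry_mem_closure ξ) t ht
  exact ⟨p, h⟩

theorem IsBoundaryMap.unique {g : Equiv.Perm (HypSpace d)} {φ ψ : Bdry d ≃ₜ Bdry d}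
    (h : IsBoundaryMap g φ) (h' : IsBoundaryMap g ψ) : φ = ψ := by
  ext ξ
  exact inclBdry_injective (tendsto_nhds_unique (h ξ) (h' ξ))

/-- The linear map `T` induces `φ` on the projectivised light cone. -/
def Induces (T : Lor d →L[ℝ] Lor d) (φ : Bdry d ≃ₜ Bdry d) : Prop :=
  ∀ ξ, 0 < lorMass (T (bdryRay ξ)) ∧ T (bdryRay ξ) = lorMass (T (bdryRay ξ)) • bdryRay (φ ξ)

theorem Induces.bdryRay_eq {T : Lor d →L[ℝ] Lor d} {φ : Bdry d ≃ₜ Bdry d} (h : Induces T φ)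
    (ξ : Bdry d) : bdryRay (φ ξ) = (lorMass (T (bdryRay ξ)))⁻¹ • T (bdryRay ξ) := by
  rw [eq_inv_smul_iff₀ (h ξ).1.ne']
  exact (h ξ).2.symm

theorem Induces.unique {T : Lor d →L[ℝ] Lor d} {φ ψ : Bdry d ≃ₜ Bdry d} (h : Induces T φ)
    (h' : Induces T ψ) : φ = ψ := by
  ext ξ
  exact bdryRay_injective ((h.bdryRay_eq ξ).trans (h'.bdryRay_eq ξ).symm)

theorem Induces.mul {T T' : Lor d →L[ℝ] Lor d} {φ φ' : Bdry d ≃ₜ Bdry d} (h : Induces T φ)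
    (h' : Induces T' φ') : Induces (T * T') (φ * φ') := by
  intro ξ
  have e : (T * T') (bdryRay ξ) = (lorMass (T' (bdryRay ξ)) * lorMass (T (bdryRay (φ' ξ)))) •
      bdryRay (φ (φ' ξ)) := by
    rw [mul_apply_eq_comp, (h' ξ).2, map_smul, (h (φ' ξ)).2]
    simp only [map_smul, lorMass_bdryRay, smul_smul, smul_eq_mul, mul_one]
  have e' : lorMass ((T * T') (bdryRay ξ)) =
      lorMass (T' (bdryRay ξ)) * lorMass (T (bdryRay (φ' ξ))) := by
    rw [e, map_smul, lorMass_bdryRay, smul_eq_mul, mul_one]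
  exact ⟨e' ▸ mul_pos (h' ξ).1 (h (φ' ξ)).1, by rw [e']; exact e⟩

theorem exists_induces {T T' : Lor d →L[ℝ] Lor d} (h : T * T' = 1) (h' : T' * T = 1)
    (hT : Set.MapsTo T (lightCone d) (lightCone d))
    (hT' : Set.MapsTo T' (lightCone d) (lightCone d)) :
    ∃ φ : Bdry d ≃ₜ Bdry d, Induces T φ ∧ Induces T' φ⁻¹ := by
  have aux : ∀ {R R' : Lor d →L[ℝ] Lor d}, R' * R = 1 →
      Set.MapsTo R (lightCone d) (lightCone d) → ∃ f : Bdry d → Bdry d, Continuous f ∧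
        ∀ ξ, 0 < lorMass (R (bdryRay ξ)) ∧
          R (bdryRay ξ) = lorMass (R (bdryRay ξ)) • bdryRay (f ξ) := by
    intro R R' hR hm
    have hne : ∀ ξ : Bdry d, R (bdryRay ξ) ≠ 0 := by
      intro ξ h0
      have h1 := lorMass_bdryRay ξ
      have h2 : R' (R (bdryRay ξ)) = bdryRay ξ := by rw [← mul_apply_eq_comp, hR]; rfl
      rw [← h2, h0] at h1
      simp at h1
    have hpos := fun ξ => lorMass_pos (hm (bdryRay_mem ξ)) (hne ξ)
    choose f hf using fun ξ => exists_eq_smul_bdryRay (hm (bdryRay_mem ξ)) (hne ξ)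
    refine ⟨f, ?_, fun ξ => ⟨hpos ξ, hf ξ⟩⟩
    rw [isClosedEmbedding_bdryRay.isInducing.continuous_iff]
    have e : bdryRay ∘ f = fun ξ => (lorMass (R (bdryRay ξ)))⁻¹ • R (bdryRay ξ) := by
      ext1 ξ
      rw [eq_inv_smul_iff₀ (hpos ξ).ne']
      exact (hf ξ).symm
    rw [e]
    have hc : Continuous fun ξ : Bdry d => R (bdryRay ξ) := R.continuous.comp continuous_bdryRay
    exact ((lorMass.continuous.comp hc).inv₀ fun ξ => (hpos ξ).ne').smul hc
  obtain ⟨f, hfc, hf⟩ := aux h' hT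
  obtain ⟨f', hfc', hf'⟩ := aux h hT'
  have inv : ∀ {R R' : Lor d →L[ℝ] Lor d} {k k' : Bdry d → Bdry d}, R' * R = 1 →
      (∀ ξ, 0 < lorMass (R (bdryRay ξ)) ∧ R (bdryRay ξ) = lorMass (R (bdryRay ξ)) • bdryRay (k ξ)) →
      (∀ ξ, 0 < lorMass (R' (bdryRay ξ)) ∧
        R' (bdryRay ξ) = lorMass (R' (bdryRay ξ)) • bdryRay (k' ξ)) → ∀ ξ, k' (k ξ) = ξ := by
    intro R R' k k' hR hk hk' ξ
    have h2 : R' (R (bdryRay ξ)) = bdryRay ξ := by rw [← mul_apply_eq_comp, hR]; rfl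
    rw [(hk ξ).2, map_smul, (hk' (k ξ)).2, smul_smul] at h2
    exact eq_of_smul_bdryRay_eq (mul_pos (hk ξ).1 (hk' _).1).ne' (h2.trans (one_smul ℝ _).symm)
  let φ : Bdry d ≃ₜ Bdry d :=
    { toFun := f
      invFun := f'
      left_inv := inv h' hf hf'
      right_inv := inv h hf' hf
      continuous_toFun := hfc
      continuous_invFun := hfc' }
  exact ⟨φ, hf, hf'⟩

theorem tendsto_of_induces {T : ι → Lor d →L[ℝ] Lor d} {φ : ι → (Bdry d ≃ₜ Bdry d)}
    {T' : Lor d →L[ℝ] Lor d} {φ' : Bdry d ≃ₜ Bdry d} (hT : Tendsto T l (𝓝 T'))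
    (h : ∀ i, Induces (T i) (φ i)) (h' : Induces T' φ') : Tendsto φ l (𝓝 φ') := by
  rw [tendsto_homeo_iff]
  intro ξ
  rw [isClosedEmbedding_bdryRay.isInducing.tendsto_nhds_iff]
  have h1 : Tendsto (fun q : ι × Bdry d => T q.1 (bdryRay q.2)) (l ×ˢ 𝓝 ξ)
      (𝓝 (T' (bdryRay ξ))) :=
    (isBoundedBilinearMap_apply.continuous.tendsto (T', bdryRay ξ)).comp
      ((hT.comp tendsto_fst).prodMk_nhds ((continuous_bdryRay.tendsto ξ).comp tendsto_snd))
  have h2 := ((lorMass.continuous.tendsto _).comp h1).inv₀ (h' ξ).1.ne'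
  rw [h'.bdryRay_eq]
  refine (h2.smul h1).congr fun q => ?_
  exact ((h q.1).bdryRay_eq q.2).symm

theorem Represents.mapsTo_lightCone {T : Lor d →L[ℝ] Lor d} {g : Equiv.Perm (HypSpace d)}
    (hg : g ∈ hypIsom d) (h : Represents T g) :
    Set.MapsTo T (lightCone d) (lightCone d) := by
  have hD : IsClosed {a : Lor d | 0 ≤ (T a).2.1 ∧ 0 ≤ (T a).2.2} := by
    have h1 : Continuous fun a : Lor d => (T a).2.1 := by fun_prop
    have h2 : Continuous fun a : Lor d => (T a).2.2 := by fun_prop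
    exact (isClosed_le continuous_const h1).inter (isClosed_le continuous_const h2)
  have hray : ∀ p, ray (inclHyp p) ∈ {a : Lor d | 0 ≤ (T a).2.1 ∧ 0 ≤ (T a).2.2} := by
    intro p
    have e : T (ray (inclHyp p)) = (lorMass (hypPt p))⁻¹ • hypPt (g p) := by
      rw [eq_inv_smul_iff₀ (lorMass_hypPt_pos p).ne', ← map_smul, ← hypPt_eq_smul_ray, h]
    have h1 := lorMass_hypPt_pos p
    have h2 := (g p).2
    simp only [Set.mem_ofPred_eq, e, hypPt, Prod.smul_mk, smul_eq_mul]
    constructor <;> positivity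
  have hbd : ∀ ξ : Bdry d, bdryRay ξ ∈ {a : Lor d | 0 ≤ (T a).2.1 ∧ 0 ≤ (T a).2.2} := by
    intro ξ
    have h1 := image_closure_subset_closure_image continuous_ray
      (Set.mem_image_of_mem ray (inclBdry_mem_closure ξ))
    refine closure_minimal ?_ hD h1
    rintro _ ⟨_, ⟨p, rfl⟩, rfl⟩
    exact hray p
  intro a ha
  rcases eq_or_ne a 0 with rfl | h0
  · rw [map_zero]; simp [lightCone]
  · obtain ⟨ξ, hξ⟩ := exists_eq_smul_bdryRay ha h0
    have hp := (lorMass_pos ha h0).le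
    have h1 := hbd ξ
    refine ⟨?_, ?_, by rw [h.lor_eq hg]; exact ha.2.2⟩
    · rw [hξ, map_smul]; exact mul_nonneg hp h1.1
    · rw [hξ, map_smul]; exact mul_nonneg hp h1.2

/-- A closed embedding of the one-point compactification of `ℝ^d × ℝ`, refining `ray`. -/
def fullRay (z : OnePoint (E d × ℝ)) : Lor d × ℝ :=
  (ray z, z.elim 0 fun q => (weight q)⁻¹ * q.2)

theorem isClosedEmbedding_fullRay : IsClosedEmbedding (fullRay (d := d)) := by
  refine Continuous.isClosedEmbedding (continuous_ray.prodMk ?_) ?_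
  · rw [OnePoint.continuous_iff]
    constructor
    · rw [coclosedCompact_eq_cocompact]
      have h0 : Tendsto (fun q : E d × ℝ => √(weight q)⁻¹) (cocompact (E d × ℝ)) (𝓝 0) := by
        simpa using (tendsto_weight (d := d)).inv_tendsto_atTop.sqrt
      refine squeeze_zero_norm (fun q => ?_) h0
      refine Real.le_sqrt_of_sq_le ?_
      have hw := weight_pos q
      simp only [OnePoint.elim_some]
      rw [norm_mul, norm_inv, Real.norm_of_nonneg hw.le, mul_pow, sq (weight q)⁻¹, mul_assoc]
      refine mul_le_of_le_one_right (by positivity) ?_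
      rw [inv_mul_le_iff₀ hw, weight, Real.norm_eq_abs, sq_abs]
      nlinarith [sq_nonneg ‖q.1‖]
    · have : Continuous fun q : E d × ℝ => (weight q)⁻¹ :=
        continuous_weight.inv₀ fun q => (weight_pos q).ne'
      simp only [OnePoint.elim_some]
      fun_prop
  · intro z z' h
    have h1 : ray z = ray z' := congrArg Prod.fst h
    have h2 := congrArg Prod.snd h
    have hw := fun q : E d × ℝ => (inv_pos.2 (weight_pos q)).ne'
    induction z using OnePoint.rec with
    | infty =>
      induction z' using OnePoint.rec with
      | infty => rfl
      | coe y =>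
        have := congrArg (fun a : Lor d => a.2.2) h1
        simp only [ray_infty, ray_coe, smul_eq_mul, Prod.smul_mk, mul_one] at this
        exact absurd this.symm (hw y)
    | coe x =>
      induction z' using OnePoint.rec with
      | infty =>
        have := congrArg (fun a : Lor d => a.2.2) h1
        simp only [ray_infty, ray_coe, smul_eq_mul, Prod.smul_mk, mul_one] at this
        exact absurd this (hw x)
      | coe y =>
        have h3 := congrArg (fun a : Lor d => a.2.2) h1
        have h4 := congrArg (fun a : Lor d => a.1) h1
        simp only [ray_coe, Prod.smul_mk, smul_eq_mul, mul_one] at h3 h4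
        simp only [fullRay, OnePoint.elim_some] at h2
        rw [h3] at h4 h2
        rw [Prod.ext (smul_right_injective _ (hw y) h4) (mul_left_cancel₀ (hw y) h2)]

theorem fullRay_inclHyp (p : HypSpace d) : fullRay (inclHyp p) =
    (ray (inclHyp p), √(lor (ray (inclHyp p)) (ray (inclHyp p)) / 2)) := by
  refine Prod.ext rfl ?_
  have hp := p.2
  have hw := weight_pos p.1
  have e : lor (ray (inclHyp p)) (ray (inclHyp p)) / 2 = ((weight p.1)⁻¹ * p.1.2) ^ 2 := by
    rw [inclHyp, ray_coe, map_smul, map_smul, LinearMap.smul_apply, lor_self]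
    simp only [smul_eq_mul]
    ring
  rw [e, Real.sqrt_sq (by positivity)]
  rfl

theorem fullRay_inclBdry (ξ : Bdry d) : fullRay (inclBdry ξ) =
    (bdryRay ξ, √(lor (bdryRay ξ) (bdryRay ξ) / 2)) := by
  rw [(bdryRay_mem ξ).2.2]
  refine Prod.ext rfl ?_
  induction ξ using OnePoint.rec with
  | infty => simp [fullRay, inclBdry]
  | coe x => simp [fullRay, inclBdry]

theorem isBoundaryMap_of_induces {T : Lor d →L[ℝ] Lor d} {g : Equiv.Perm (HypSpace d)}
    {φ : Bdry d ≃ₜ Bdry d} (h : Represents T g) (h' : Induces T φ) : IsBoundaryMap g φ := by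
  intro ξ
  have h1 : Tendsto (fun p => ray (inclHyp p)) (comap inclHyp (𝓝 (inclBdry ξ)))
      (𝓝 (bdryRay ξ)) := (continuous_ray.tendsto _).comp tendsto_comap
  have h2 := (T.continuous.tendsto _).comp h1
  have h3 := (((lorMass.continuous.tendsto _).comp h2).inv₀ (h' ξ).1.ne').smul h2
  rw [← h'.bdryRay_eq] at h3
  have h4 : Tendsto (fun p => ray (inclHyp (g p))) (comap inclHyp (𝓝 (inclBdry ξ)))
      (𝓝 (bdryRay (φ ξ))) := by
    refine h3.congr fun p => ?_
    have e : T (ray (inclHyp p)) = ((lorMass (hypPt p))⁻¹ * lorMass (hypPt (g p))) •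
        ray (inclHyp (g p)) := by
      rw [mul_smul, ← hypPt_eq_smul_ray, eq_inv_smul_iff₀ (lorMass_hypPt_pos p).ne', ← map_smul,
        ← hypPt_eq_smul_ray, h]
    have e' : lorMass (T (ray (inclHyp p))) = (lorMass (hypPt p))⁻¹ * lorMass (hypPt (g p)) := by
      rw [e, map_smul, lorMass_ray, smul_eq_mul, mul_one]
    simp only [Function.comp_apply]
    rw [inv_smul_eq_iff₀, e', e]
    rw [e']
    exact (mul_pos (inv_pos.2 (lorMass_hypPt_pos p)) (lorMass_hypPt_pos _)).ne'
  rw [isClosedEmbedding_fullRay.isInducing.tendsto_nhds_iff, fullRay_inclBdry]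
  have hc : Continuous fun a : Lor d => (a, √(lor a a / 2)) := by
    simp only [lor_self]; fun_prop
  refine ((hc.tendsto _).comp h4).congr fun p => ?_
  exact (fullRay_inclHyp _).symm

theorem exists_model {g : Equiv.Perm (HypSpace d)} (hg : g ∈ hypIsom d) :
    ∃ (T T' : Lor d →L[ℝ] Lor d) (φ : Bdry d ≃ₜ Bdry d), Represents T g ∧ Represents T' g⁻¹ ∧
      Induces T φ ∧ Induces T' φ⁻¹ ∧ IsBoundaryMap g φ := by
  obtain ⟨T, hT⟩ := exists_represents hg
  obtain ⟨T', hT'⟩ := exists_represents (inv_mem hg)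
  obtain ⟨φ, h1, h2⟩ := exists_induces (hT.mul_eq_one hT') (hT.mul_eq_one' hT')
    (hT.mapsTo_lightCone hg) (hT'.mapsTo_lightCone (inv_mem hg))
  exact ⟨T, T', φ, hT, hT', h1, h2, isBoundaryMap_of_induces hT h1⟩

theorem IsBoundaryMap.induces {g : Equiv.Perm (HypSpace d)} {φ : Bdry d ≃ₜ Bdry d}
    (h : IsBoundaryMap g φ) (hg : g ∈ hypIsom d) {T : Lor d →L[ℝ] Lor d} (hT : Represents T g) :
    Induces T φ := by
  obtain ⟨T₁, -, φ₁, h1, -, h2, -, h3⟩ := exists_model hg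
  rwa [hT.unique h1, h.unique h3]

theorem IsBoundaryMap.mul {g g' : Equiv.Perm (HypSpace d)} {φ φ' : Bdry d ≃ₜ Bdry d}
    (h : IsBoundaryMap g φ) (h' : IsBoundaryMap g' φ') (hg : g ∈ hypIsom d)
    (hg' : g' ∈ hypIsom d) : IsBoundaryMap (g * g') (φ * φ') := by
  obtain ⟨T, hT⟩ := exists_represents hg
  obtain ⟨T', hT'⟩ := exists_represents hg'
  exact isBoundaryMap_of_induces (hT.mul hT') ((h.induces hg hT).mul (h'.induces hg' hT'))

theorem IsBoundaryMap.inv {g : Equiv.Perm (HypSpace d)} {φ : Bdry d ≃ₜ Bdry d}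
    (h : IsBoundaryMap g φ) (hg : g ∈ hypIsom d) : IsBoundaryMap g⁻¹ φ⁻¹ := by
  obtain ⟨T, T', φ', -, h2, -, h4, h5⟩ := exists_model hg
  rw [h.unique h5]
  exact isBoundaryMap_of_induces h2 h4

theorem lor_comm (a b : Lor d) : lor a b = lor b a := by
  rw [lor_apply, lor_apply, real_inner_comm]; ring

theorem norm_hypPt_le (p : HypSpace d) : ‖hypPt p‖ ≤ lorMass (hypPt p) := by
  have hp := p.2
  have h1 : 0 ≤ (hypPt p).2.1 := by simp only [hypPt]; positivity
  have h2 : 0 ≤ (hypPt p).2.2 := by simp only [hypPt]; positivity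
  have h3 : ‖(hypPt p).1‖ ^ 2 ≤ (hypPt p).2.1 * (hypPt p).2.2 := by
    have := two_le_lor_hypPt p p
    rw [lor_self] at this
    linarith
  rw [lorMass_apply]
  refine max_le ?_ (max_le ?_ ?_)
  · refine abs_le_of_sq_le_sq' ?_ (add_nonneg h1 h2) |>.2
    nlinarith [mul_nonneg h1 h2]
  · rw [Real.norm_of_nonneg h1]; linarith
  · rw [Real.norm_of_nonneg h2]; linarith

theorem lorMass_hypPt_inv {g : Equiv.Perm (HypSpace d)} (hg : g ∈ hypIsom d) :
    lorMass (hypPt (g⁻¹ (basePt d))) = lorMass (hypPt (g (basePt d))) := by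
  have h := hdist_eq_hdist_iff.1 (hg (g⁻¹ (basePt d)) (basePt d))
  rw [show g (g⁻¹ (basePt d)) = basePt d from g.apply_symm_apply _] at h
  rw [← lor_basePt, ← h, lor_comm, lor_basePt]

theorem exists_norm_le {g : ℕ → Equiv.Perm (HypSpace d)} (hg : ∀ k, g k ∈ hypIsom d)
    {T : ℕ → Lor d →L[ℝ] Lor d} (hT : ∀ k, Represents (T k) (g k)) {c : ℝ}
    (hc : ∀ k, lorMass (hypPt (g k (basePt d))) ≤ c) : ∃ C, ∀ k, ‖T k‖ ≤ C := by
  refine banach_steinhaus fun a => ?_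
  have ha : a ∈ Submodule.span ℝ (Set.range (hypPt (d := d))) := span_hypPt ▸ Submodule.mem_top
  induction ha using Submodule.span_induction with
  | mem a h =>
    obtain ⟨p, rfl⟩ := h
    refine ⟨‖(lor (hypPt p)).toContinuousLinearMap‖ * c, fun k => ?_⟩
    rw [hT k p]
    refine (norm_hypPt_le _).trans ?_
    have h1 := hdist_eq_hdist_iff.1 (hg k p ((g k)⁻¹ (basePt d)))
    rw [show g k ((g k)⁻¹ (basePt d)) = basePt d from (g k).apply_symm_apply _, lor_basePt] at h1
    rw [h1]
    refine (le_abs_self _).trans (((lor (hypPt p)).toContinuousLinearMap.le_opNorm _).trans ?_)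
    refine mul_le_mul_of_nonneg_left ?_ (norm_nonneg _)
    exact (norm_hypPt_le _).trans ((lorMass_hypPt_inv (hg k)).le.trans (hc k))
  | zero => exact ⟨0, fun k => by simp⟩
  | add a b _ _ ha hb =>
    obtain ⟨C, hC⟩ := ha
    obtain ⟨D, hD⟩ := hb
    exact ⟨C + D, fun k => by rw [map_add]; exact norm_add_le_of_le (hC k) (hD k)⟩
  | smul r a _ ha =>
    obtain ⟨C, hC⟩ := ha
    exact ⟨‖r‖ * C, fun k => by
      rw [map_smul, norm_smul]; exact mul_le_mul_of_nonneg_left (hC k) (norm_nonneg _)⟩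

/-- Isometries moving the base point a bounded amount subconverge. -/
theorem exists_subseq_tendsto {g : ℕ → Equiv.Perm (HypSpace d)} (hg : ∀ k, g k ∈ hypIsom d)
    {T T' : ℕ → Lor d →L[ℝ] Lor d} (hT : ∀ k, Represents (T k) (g k))
    (hT' : ∀ k, Represents (T' k) (g k)⁻¹) {φ : ℕ → (Bdry d ≃ₜ Bdry d)}
    (hφ : ∀ k, IsBoundaryMap (g k) (φ k)) {c : ℝ}
    (hc : ∀ k, lorMass (hypPt (g k (basePt d))) ≤ c) :
    ∃ κ : ℕ → ℕ, StrictMono κ ∧ ∃ (R R' : Lor d →L[ℝ] Lor d) (Φ : Bdry d ≃ₜ Bdry d),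
      Tendsto (fun k => T (κ k)) atTop (𝓝 R) ∧ Tendsto (fun k => T' (κ k)) atTop (𝓝 R') ∧
      R * R' = 1 ∧ R' * R = 1 ∧ Tendsto (fun k => φ (κ k)) atTop (𝓝 Φ) := by
  obtain ⟨C, hC⟩ := exists_norm_le hg hT hc
  obtain ⟨C', hC'⟩ := exists_norm_le (fun k => inv_mem (hg k)) hT'
    (fun k => (lorMass_hypPt_inv (hg k)).le.trans (hc k))
  have : ProperSpace ((Lor d →L[ℝ] Lor d) × (Lor d →L[ℝ] Lor d)) :=
    FiniteDimensional.proper_real _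
  obtain ⟨⟨R, R'⟩, -, κ, hκ, hlim⟩ := tendsto_subseq_of_bounded
    (s := Metric.closedBall (0 : (Lor d →L[ℝ] Lor d) × (Lor d →L[ℝ] Lor d)) (max C C'))
    Metric.isBounded_closedBall (x := fun k => (T k, T' k)) (fun k => by
      rw [mem_closedBall_zero_iff]
      exact max_le_max (hC k) (hC' k))
  have h1 : Tendsto (fun k => T (κ k)) atTop (𝓝 R) := (continuous_fst.tendsto _).comp hlim
  have h2 : Tendsto (fun k => T' (κ k)) atTop (𝓝 R') := (continuous_snd.tendsto _).comp hlim
  have e1 : R * R' = 1 := tendsto_nhds_unique (h1.mul h2)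
    (tendsto_const_nhds.congr fun k => ((hT (κ k)).mul_eq_one (hT' (κ k))).symm)
  have e2 : R' * R = 1 := tendsto_nhds_unique (h2.mul h1)
    (tendsto_const_nhds.congr fun k => ((hT (κ k)).mul_eq_one' (hT' (κ k))).symm)
  have cone : ∀ {X : ℕ → Lor d →L[ℝ] Lor d} {Y : Lor d →L[ℝ] Lor d}, Tendsto X atTop (𝓝 Y) →
      (∀ k, Set.MapsTo (X k) (lightCone d) (lightCone d)) →
      Set.MapsTo Y (lightCone d) (lightCone d) := by
    intro X Y hX hm a ha
    exact isClosed_lightCone.mem_of_tendsto (((ContinuousLinearMap.apply ℝ (Lor d) a).continuous.tendsto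
      Y).comp hX) (Eventually.of_forall fun k => hm k ha)
  obtain ⟨Φ, hΦ, -⟩ := exists_induces e1 e2
    (cone h1 fun k => (hT (κ k)).mapsTo_lightCone (hg _))
    (cone h2 fun k => (hT' (κ k)).mapsTo_lightCone (inv_mem (hg _)))
  exact ⟨κ, hκ, R, R', Φ, h1, h2, e1, e2,
    tendsto_of_induces h1 (fun k => (hφ (κ k)).induces (hg _) (hT _)) hΦ⟩

/-- The similarity `x ↦ s x + a` of the upper half-space. -/
def similarity (a : E d) {s : ℝ} (hs : 0 < s) : Equiv.Perm (HypSpace d) where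
  toFun p := mkPt (s • p.1.1 + a) (s * p.1.2) (mul_pos hs p.2)
  invFun p := mkPt (s⁻¹ • (p.1.1 - a)) (s⁻¹ * p.1.2) (mul_pos (inv_pos.2 hs) p.2)
  left_inv p := by
    apply Subtype.ext
    ext1
    · simp [mkPt, smul_smul, hs.ne']
    · simp [mkPt, hs.ne']
  right_inv p := by
    apply Subtype.ext
    ext1
    · simp [mkPt, smul_smul, hs.ne']
    · simp [mkPt, hs.ne']

theorem similarity_mem (a : E d) {s : ℝ} (hs : 0 < s) : similarity a hs ∈ hypIsom d := by
  intro p q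
  rw [hdist_eq_hdist_iff, lor_hypPt, lor_hypPt]
  have hp := p.2.ne'
  have hq := q.2.ne'
  have e : ‖s • p.1.1 + a - (s • q.1.1 + a)‖ ^ 2 = s ^ 2 * ‖p.1.1 - q.1.1‖ ^ 2 := by
    rw [add_sub_add_right_eq_sub, ← smul_sub, norm_smul, mul_pow, Real.norm_of_nonneg hs.le]
  simp only [similarity, Equiv.coe_fn_mk, mkPt, e]
  field_simp

/-- The boundary map `x ↦ s x + a` of `similarity`. -/
def bdrySimilarity (a : E d) {s : ℝ} (hs : 0 < s) : Bdry d ≃ₜ Bdry d :=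
  ((Homeomorph.smulOfNeZero s hs.ne').trans (Homeomorph.addRight a)).onePointCongr

@[simp] theorem bdrySimilarity_coe (a : E d) {s : ℝ} (hs : 0 < s) (x : E d) :
    bdrySimilarity a hs (x : Bdry d) = ((s • x + a : E d) : Bdry d) := rfl

theorem bdrySimilarity_inv_coe (a : E d) {s : ℝ} (hs : 0 < s) (x : E d) :
    (bdrySimilarity a hs)⁻¹ (x : Bdry d) = ((s⁻¹ • (x - a) : E d) : Bdry d) := by
  rw [Homeomorph.inv_apply, Homeomorph.symm_apply_eq, bdrySimilarity_coe, smul_smul,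
    mul_inv_cancel₀ hs.ne', one_smul, sub_add_cancel]

theorem isBoundaryMap_similarity (a : E d) {s : ℝ} (hs : 0 < s) :
    IsBoundaryMap (similarity a hs) (bdrySimilarity a hs) := by
  let H : E d × ℝ ≃ₜ E d × ℝ :=
    (Homeomorph.smulOfNeZero s hs.ne').trans (Homeomorph.addRight (a, 0))
  have h1 : ∀ ξ : Bdry d, H.onePointCongr (inclBdry ξ) = inclBdry (bdrySimilarity a hs ξ) := by
    intro ξ
    induction ξ using OnePoint.rec with
    | infty => rfl
    | coe x =>
      refine congrArg OnePoint.some (Prod.ext rfl ?_)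
      change s • (0 : ℝ) + 0 = 0
      simp
  have h2 : ∀ p : HypSpace d, H.onePointCongr (inclHyp p) = inclHyp (similarity a hs p) := by
    intro p
    refine congrArg OnePoint.some (Prod.ext rfl ?_)
    change s • p.1.2 + 0 = s * p.1.2
    simp
  intro ξ
  rw [← h1]
  exact ((H.onePointCongr.continuous.tendsto _).comp tendsto_comap).congr h2

theorem linExt_mul_bdrySimilarity (A : E d ≃L[ℝ] E d) {s : ℝ} (hs : 0 < s) :
    linExt A * bdrySimilarity 0 hs = bdrySimilarity 0 hs * linExt A := by
  ext ξ
  induction ξ using OnePoint.rec with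
  | infty => rfl
  | coe x => simp

/-- A cocompact group contains approximate inverses of all isometries. -/
theorem exists_subseq_boundaryMaps {G : Subgroup (Equiv.Perm (HypSpace d))}
    (hG : IsCocompactKleinian G) {g : ℕ → Equiv.Perm (HypSpace d)} (hg : ∀ k, g k ∈ hypIsom d)
    {φ : ℕ → (Bdry d ≃ₜ Bdry d)} (hφ : ∀ k, IsBoundaryMap (g k) (φ k)) :
    ∃ κ : ℕ → ℕ, StrictMono κ ∧ ∃ (Γ : ℕ → (Bdry d ≃ₜ Bdry d)) (Ψ : Bdry d ≃ₜ Bdry d),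
      (∀ k, Γ k ∈ boundaryMaps G) ∧ Tendsto (fun k => Γ k * φ (κ k)) atTop (𝓝 Ψ) := by
  obtain ⟨K, hK, hKG⟩ := hG.cocompact
  have hcont : ContinuousOn (fun p : HypSpace d => lorMass (hypPt p)) K := by
    have h1 : Continuous fun p : HypSpace d => (p.1.2)⁻¹ :=
      (continuous_snd.comp continuous_subtype_val).inv₀ fun p => p.2.ne'
    simp only [lorMass_apply, hypPt, div_eq_mul_inv]
    exact Continuous.continuousOn (by fun_prop)
  obtain ⟨c, hc⟩ := (hK.bddAbove_image hcont)
  choose γ hγ hγK using fun k => hKG (g k (basePt d))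
  have hm : ∀ k, γ k * g k ∈ hypIsom d := fun k => mul_mem (hG.isometries (hγ k)) (hg k)
  choose Tγ Tγ' Γ _ _ _ _ hΓ using fun k => exists_model (hG.isometries (hγ k))
  choose T T' Ω hT hT' _ _ _ using fun k => exists_model (hm k)
  obtain ⟨κ, hκ, R, R', Φ, -, -, -, -, hlim⟩ := exists_subseq_tendsto hm hT hT'
    (fun k => (hΓ k).mul (hφ k) (hG.isometries (hγ k)) (hg k))
    (c := c) (fun k => hc ⟨_, hγK k, rfl⟩)
  exact ⟨κ, hκ, fun k => Γ (κ k), Φ, fun k => ⟨γ (κ k), hγ _, hΓ _⟩, hlim⟩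

/-- The finite coordinate of a boundary point (and `0` at `∞`). -/
def finPart (ξ : Bdry d) : E d := ξ.elim 0 id

@[simp] theorem finPart_coe (x : E d) : finPart (x : Bdry d) = x := rfl

theorem tendsto_finPart (x : E d) : Tendsto finPart (𝓝 (x : Bdry d)) (𝓝 x) := by
  rw [OnePoint.nhds_coe_eq, tendsto_map'_iff]
  exact tendsto_id

theorem eventually_eq_finPart (x : E d) :
    ∀ᶠ ξ in 𝓝 (x : Bdry d), ξ = ((finPart ξ : E d) : Bdry d) := by
  rw [OnePoint.nhds_coe_eq, eventually_map]
  exact Eventually.of_forall fun _ => rfl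

theorem exists_pow_eq {f : Bdry d ≃ₜ Bdry d} {v : E d} {R s η r t : ℝ} (hs : 0 ≤ s) (hη : 0 ≤ η)
    (hR : r + t * (‖v‖ + η) ≤ R)
    (hf : ∀ x : E d, ‖x‖ ≤ R → ∃ u : E d, f (x : Bdry d) = ((x + s • u : E d) : Bdry d) ∧
      ‖u - v‖ ≤ η) {x : E d} (hx : ‖x‖ ≤ r) (j : ℕ) (hj : j * s ≤ t) :
    ∃ y : E d, (f ^ j) (x : Bdry d) = (y : Bdry d) ∧ ‖y - x - (j * s) • v‖ ≤ j * s * η := by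
  induction j with
  | zero => exact ⟨x, rfl, by simp⟩
  | succ j ih =>
    have hjs : (j : ℝ) * s ≤ t := by
      refine le_trans ?_ hj
      push_cast
      nlinarith
    obtain ⟨y, hy, hyx⟩ := ih hjs
    have hjs0 : 0 ≤ (j : ℝ) * s := by positivity
    have hyR : ‖y‖ ≤ R := by
      have e : y = (y - x - (j * s) • v) + x + (j * s) • v := by abel
      have h1 : ‖y‖ ≤ j * s * η + r + j * s * ‖v‖ := by
        rw [e]
        refine norm_add_le_of_le (norm_add_le_of_le hyx hx) ?_
        rw [norm_smul, Real.norm_of_nonneg hjs0]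
      nlinarith [mul_le_mul_of_nonneg_right hjs (add_nonneg (norm_nonneg v) hη)]
    obtain ⟨u, hu, huv⟩ := hf y hyR
    refine ⟨y + s • u, by rw [pow_succ', Homeomorph.mul_apply, hy, hu], ?_⟩
    have e : y + s • u - x - (((j + 1 : ℕ) : ℝ) * s) • v =
        (y - x - (j * s) • v) + s • (u - v) := by
      push_cast
      module
    have e' : ((j + 1 : ℕ) : ℝ) * s * η = j * s * η + s * η := by push_cast; ring
    rw [e, e']
    refine norm_add_le_of_le hyx ?_
    rw [norm_smul, Real.norm_of_nonneg hs]
    exact mul_le_mul_of_nonneg_left huv hs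

theorem tendsto_zoom_pow {h : ℕ → (Bdry d ≃ₜ Bdry d)} {p v : E d} {s : ℕ → ℝ}
    (hs : ∀ k, 0 < s k) (hs0 : Tendsto s atTop (𝓝 0)) {w : ℕ → E d → E d}
    (hw : Tendsto (fun q : ℕ × E d => w q.1 q.2) (atTop ×ˢ 𝓝 p) (𝓝 v))
    (hh : ∀ᶠ q : ℕ × E d in atTop ×ˢ 𝓝 p,
      h q.1 (q.2 : Bdry d) = ((q.2 + s q.1 ^ 2 • w q.1 q.2 : E d) : Bdry d))
    {t : ℝ} (ht : 0 ≤ t) (x₀ : E d) :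
    Tendsto (fun q : ℕ × E d =>
        (((bdrySimilarity p (hs q.1))⁻¹ * h q.1 * bdrySimilarity p (hs q.1)) ^ ⌊t / s q.1⌋₊)
          (q.2 : Bdry d))
      (atTop ×ˢ 𝓝 x₀) (𝓝 ((x₀ + t • v : E d) : Bdry d)) := by
  rw [OnePoint.nhds_coe_eq]
  intro U hU
  obtain ⟨ε, hε, hεU⟩ := Metric.mem_nhds_iff.1 (mem_map.1 hU)
  obtain ⟨η, hη, hη1⟩ : ∃ η > 0, t * η ≤ ε / 4 :=
    ⟨ε / (4 * (t + 1)), by positivity, by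
      rw [mul_div_assoc', div_le_div_iff₀ (by positivity) (by positivity)]
      nlinarith⟩
  have h1 : ∀ᶠ q : ℕ × E d in atTop ×ˢ 𝓝 p,
      h q.1 (q.2 : Bdry d) = ((q.2 + s q.1 ^ 2 • w q.1 q.2 : E d) : Bdry d) ∧
        ‖w q.1 q.2 - v‖ ≤ η := by
    refine hh.and ?_
    filter_upwards [hw (Metric.closedBall_mem_nhds v hη)] with q hq
    exact mem_closedBall_iff_norm.1 hq
  obtain ⟨P, hP, Q, hQ, hPQ⟩ := eventually_prod_iff.1 h1
  obtain ⟨ρ, hρ, hρQ⟩ := Metric.eventually_nhds_iff_ball.1 hQ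
  set R := ‖x₀‖ + 1 + t * (‖v‖ + η) with hR
  have hR0 : 0 < R + 1 := by positivity
  have h2 : ∀ᶠ k in atTop, s k < ρ / (R + 1) := hs0.eventually_lt_const (by positivity)
  have h3 : ∀ᶠ k in atTop, s k < ε / (4 * (‖v‖ + 1)) := hs0.eventually_lt_const (by positivity)
  have h4 : ∀ᶠ x in 𝓝 x₀, ‖x - x₀‖ < min 1 (ε / 4) := by
    filter_upwards [Metric.ball_mem_nhds x₀ (lt_min one_pos (by positivity : 0 < ε / 4))] with x hx
    exact mem_ball_iff_norm.1 hx
  rw [mem_map]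
  filter_upwards [(hP.and (h2.and h3)).prod_mk h4] with q ⟨⟨hPk, hk2, hk3⟩, hx⟩
  obtain ⟨k, x⟩ := q
  simp only at hPk hk2 hk3 hx ⊢
  have hsk := hs k
  have hf : ∀ x : E d, ‖x‖ ≤ R → ∃ u : E d,
      ((bdrySimilarity p (hs k))⁻¹ * h k * bdrySimilarity p (hs k)) (x : Bdry d) =
        ((x + s k • u : E d) : Bdry d) ∧ ‖u - v‖ ≤ η := by
    intro x hx
    have hmem : s k • x + p ∈ Metric.ball p ρ := by
      rw [mem_ball_iff_norm, add_sub_cancel_right, norm_smul, Real.norm_of_nonneg hsk.le]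
      rw [lt_div_iff₀ hR0] at hk2
      nlinarith
    obtain ⟨h5, h6⟩ := hPQ hPk (hρQ _ hmem)
    refine ⟨w k (s k • x + p), ?_, h6⟩
    simp only at h5
    rw [Homeomorph.mul_apply, Homeomorph.mul_apply, bdrySimilarity_coe, h5,
      bdrySimilarity_inv_coe]
    congr 1
    have e : s k • x + p + s k ^ 2 • w k (s k • x + p) - p =
        s k • (x + s k • w k (s k • x + p)) := by module
    rw [e, smul_smul, inv_mul_cancel₀ hsk.ne', one_smul]
  have hfl : (⌊t / s k⌋₊ : ℝ) * s k ≤ t := by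
    rw [← le_div_iff₀ hsk]
    exact Nat.floor_le (by positivity)
  have hfl' : t - (⌊t / s k⌋₊ : ℝ) * s k ≤ s k := by
    have := Nat.lt_floor_add_one (t / s k)
    rw [div_lt_iff₀ hsk] at this
    linarith
  have hxr : ‖x‖ ≤ ‖x₀‖ + 1 := by
    have := norm_sub_norm_le x x₀
    linarith [hx.trans_le (min_le_left _ _)]
  obtain ⟨y, hy, hyx⟩ := exists_pow_eq hsk.le hη.le hR.ge hf hxr _ hfl
  suffices hm : y ∈ Metric.ball (x₀ + t • v) ε by
    have hyU := hεU hm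
    rw [Set.mem_preimage, ← hy] at hyU
    exact hyU
  rw [mem_ball_iff_norm]
  have e : y - (x₀ + t • v) = (y - x - ((⌊t / s k⌋₊ : ℝ) * s k) • v) + (x - x₀) -
      (t - (⌊t / s k⌋₊ : ℝ) * s k) • v := by module
  have h7 : ‖(t - (⌊t / s k⌋₊ : ℝ) * s k) • v‖ ≤ s k * ‖v‖ := by
    rw [norm_smul, Real.norm_of_nonneg (by linarith)]
    exact mul_le_mul_of_nonneg_right hfl' (norm_nonneg v)
  have h8 : s k * ‖v‖ ≤ ε / 4 := by
    rw [lt_div_iff₀ (by positivity)] at hk3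
    nlinarith
  have h9 : (⌊t / s k⌋₊ : ℝ) * s k * η ≤ ε / 4 :=
    (mul_le_mul_of_nonneg_right hfl hη.le).trans hη1
  rw [e]
  refine (norm_sub_le_of_le (norm_add_le_of_le hyx (hx.le.trans (min_le_right _ _))) h7).trans_lt ?_
  linarith

theorem zoom_inv_pow (z h : Bdry d ≃ₜ Bdry d) (m : ℕ) :
    ((z⁻¹ * h * z) ^ m)⁻¹ = (z⁻¹ * h⁻¹ * z) ^ m := by
  rw [← inv_pow]
  simp only [mul_inv_rev, inv_inv, mul_assoc]

theorem tendsto_translation {h : ℕ → (Bdry d ≃ₜ Bdry d)} {p v : E d} {s : ℕ → ℝ}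
    (hs : ∀ k, 0 < s k) (hs0 : Tendsto s atTop (𝓝 0)) {w : ℕ → E d → E d}
    (hlim : Tendsto h atTop (𝓝 1))
    (hw : Tendsto (fun q : ℕ × E d => w q.1 q.2) (atTop ×ˢ 𝓝 p) (𝓝 v))
    (hh : ∀ᶠ q : ℕ × E d in atTop ×ˢ 𝓝 p,
      h q.1 (q.2 : Bdry d) = ((q.2 + s q.1 ^ 2 • w q.1 q.2 : E d) : Bdry d))
    {t : ℝ} (ht : 0 ≤ t) :
    Tendsto (fun k => ((bdrySimilarity p (hs k))⁻¹ * h k * bdrySimilarity p (hs k)) ^ ⌊t / s k⌋₊)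
      atTop (𝓝 (translation (t • v))) := by
  have hinv : Tendsto (fun q : ℕ × E d => (h q.1)⁻¹ (q.2 : Bdry d)) (atTop ×ˢ 𝓝 p)
      (𝓝 (p : Bdry d)) := by
    have h1 := tendsto_homeo_iff.1 (homeo_tendsto_inv hlim) (p : Bdry d)
    rw [inv_one] at h1
    exact h1.comp (tendsto_fst.prodMk ((OnePoint.continuous_coe.tendsto p).comp tendsto_snd))
  have hx : Tendsto (fun q : ℕ × E d => (q.1, finPart ((h q.1)⁻¹ (q.2 : Bdry d))))
      (atTop ×ˢ 𝓝 p) (atTop ×ˢ 𝓝 p) :=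
    tendsto_fst.prodMk ((tendsto_finPart p).comp hinv)
  refine tendsto_onePointCongr (fun x => tendsto_zoom_pow hs hs0 hw hh ht x) (fun x => ?_)
  have hw' : Tendsto (fun q : ℕ × E d => -w q.1 (finPart ((h q.1)⁻¹ (q.2 : Bdry d))))
      (atTop ×ˢ 𝓝 p) (𝓝 (-v)) := (hw.comp hx).neg
  have hh' : ∀ᶠ q : ℕ × E d in atTop ×ˢ 𝓝 p, (h q.1)⁻¹ (q.2 : Bdry d) =
      ((q.2 + s q.1 ^ 2 • -w q.1 (finPart ((h q.1)⁻¹ (q.2 : Bdry d))) : E d) : Bdry d) := by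
    filter_upwards [hx.eventually hh, hinv.eventually (eventually_eq_finPart p)] with q h1 h2
    rw [← h2] at h1
    have h3 : h q.1 ((h q.1)⁻¹ (q.2 : Bdry d)) = q.2 := (h q.1).apply_symm_apply _
    rw [h3, OnePoint.coe_eq_coe] at h1
    rw [h2, OnePoint.coe_eq_coe, finPart_coe, smul_neg]
    exact eq_add_neg_of_add_eq h1.symm
  have h1 := tendsto_zoom_pow (h := fun k => (h k)⁻¹)
    (w := fun k y => -w k (finPart ((h k)⁻¹ (y : Bdry d)))) hs hs0 hw' hh' ht x
  simp only [zoom_inv_pow]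
  convert h1 using 3
  rw [smul_neg]
  rfl

/-- The light cone vector of a point of `ℝ^d`, normalised to have last coordinate `1`. -/
def coneVec (x : E d) : Lor d := (x, ‖x‖ ^ 2, 1)

theorem continuous_coneVec : Continuous (coneVec (d := d)) := by unfold coneVec; fun_prop

theorem Induces.apply_coe {T : Lor d →L[ℝ] Lor d} {φ : Bdry d ≃ₜ Bdry d} (h : Induces T φ)
    {x : E d} (hx : (T (coneVec x)).2.2 ≠ 0) :
    φ (x : Bdry d) = (((T (coneVec x)).2.2⁻¹ • (T (coneVec x)).1 : E d) : Bdry d) := by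
  have hpos : (1 + ‖x‖ ^ 2 : ℝ) ≠ 0 := by positivity
  have e : coneVec x = (1 + ‖x‖ ^ 2) • bdryRay (x : Bdry d) := by
    rw [bdryRay_coe, smul_smul, mul_inv_cancel₀ hpos, one_smul, coneVec]
  have e' : T (coneVec x) = ((1 + ‖x‖ ^ 2) * lorMass (T (bdryRay (x : Bdry d)))) •
      bdryRay (φ (x : Bdry d)) := by
    rw [e, map_smul, (h x).2]
    simp only [map_smul, lorMass_bdryRay, smul_smul, smul_eq_mul, mul_one]
  set c := (1 + ‖x‖ ^ 2) * lorMass (T (bdryRay (x : Bdry d))) with hc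
  have hc0 : c ≠ 0 := mul_ne_zero hpos (h x).1.ne'
  generalize φ (x : Bdry d) = η at e' ⊢
  induction η using OnePoint.rec with
  | infty =>
    rw [e', bdryRay_infty] at hx
    simp at hx
  | coe y =>
    have hy : (1 + ‖y‖ ^ 2 : ℝ) ≠ 0 := by positivity
    rw [OnePoint.coe_eq_coe, e', bdryRay_coe]
    simp only [Prod.smul_mk, smul_eq_mul, mul_one, smul_smul]
    rw [show (c * (1 + ‖y‖ ^ 2)⁻¹)⁻¹ * (c * (1 + ‖y‖ ^ 2)⁻¹) = 1 by field_simp, one_smul]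

theorem Induces.snd_snd_ne_zero {T : Lor d →L[ℝ] Lor d} {φ : Bdry d ≃ₜ Bdry d} (h : Induces T φ)
    {x : E d} (hx : φ (x : Bdry d) ≠ ∞) : (T (coneVec x)).2.2 ≠ 0 := by
  have hpos : (1 + ‖x‖ ^ 2 : ℝ) ≠ 0 := by positivity
  have e : coneVec x = (1 + ‖x‖ ^ 2) • bdryRay (x : Bdry d) := by
    rw [bdryRay_coe, smul_smul, mul_inv_cancel₀ hpos, one_smul, coneVec]
  rw [e, map_smul, (h x).2]
  have hm := (h x).1.ne'
  generalize lorMass (T (bdryRay (x : Bdry d))) = m at hm ⊢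
  generalize φ (x : Bdry d) = η at hx ⊢
  induction η using OnePoint.rec with
  | infty => exact absurd rfl hx
  | coe y =>
    have hy : (1 + ‖y‖ ^ 2 : ℝ) ≠ 0 := by positivity
    rw [bdryRay_coe]
    simp only [Prod.smul_snd, smul_eq_mul, mul_one]
    exact mul_ne_zero hpos (mul_ne_zero hm (inv_ne_zero hy))

/-- The closed unit ball of `ℝ^d`. -/
abbrev UnitBall (d : ℕ) : Type := Metric.closedBall (0 : E d) 1

instance : CompactSpace (UnitBall d) := isCompact_iff_compactSpace.1 (isCompact_closedBall _ _)

/-- The affine functions on the unit ball. -/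
def affineFunctions (d : ℕ) : Submodule ℝ C(UnitBall d, ℝ) :=
  Submodule.span ℝ (insert 1 (Set.range fun i : Fin d => ⟨fun x : UnitBall d => x.1 i, by fun_prop⟩))

theorem fg_affineFunctions : (affineFunctions d).FG :=
  Submodule.fg_span ((Set.finite_range _).insert _)

theorem one_mem_affineFunctions : 1 ∈ affineFunctions d :=
  Submodule.subset_span (Set.mem_insert _ _)

theorem linear_mem_affineFunctions (ℓ : E d →L[ℝ] ℝ) :
    (⟨fun x : UnitBall d => ℓ x, by fun_prop⟩ : C(UnitBall d, ℝ)) ∈ affineFunctions d := by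
  have e : (⟨fun x : UnitBall d => ℓ x, by fun_prop⟩ : C(UnitBall d, ℝ)) =
      ∑ i, ℓ (EuclideanSpace.single i 1) • ⟨fun x : UnitBall d => x.1 i, by fun_prop⟩ := by
    ext x
    have h1 := (EuclideanSpace.basisFun (Fin d) ℝ).sum_repr x.1
    simp only [ContinuousMap.coe_mk, ContinuousMap.coe_sum, Finset.sum_apply,
      ContinuousMap.smul_apply, smul_eq_mul]
    conv_lhs => rw [← h1, map_sum]
    refine Finset.sum_congr rfl fun i _ => ?_
    simp [mul_comm]
  rw [e]
  exact Submodule.sum_mem _ fun i _ => Submodule.smul_mem _ _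
    (Submodule.subset_span (Set.mem_insert_of_mem _ ⟨i, rfl⟩))

theorem quadratic_mem (Λ : Lor d →L[ℝ] ℝ) (C : E d →L[ℝ] E d)
    (hc : Continuous fun x : UnitBall d => Λ (coneVec (C x))) :
    (⟨fun x : UnitBall d => Λ (coneVec (C x)), hc⟩ : C(UnitBall d, ℝ)) ∈
      affineFunctions d * affineFunctions d := by
  let lin (ℓ : E d →L[ℝ] ℝ) : C(UnitBall d, ℝ) := ⟨fun x : UnitBall d => ℓ x, by fun_prop⟩
  have e : (⟨fun x : UnitBall d => Λ (coneVec (C x)), hc⟩ : C(UnitBall d, ℝ)) =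
      1 * lin ((Λ.comp (ContinuousLinearMap.inl ℝ (E d) (ℝ × ℝ))).comp C) +
      Λ (0, 1, 0) • ∑ i, lin ((EuclideanSpace.proj i).comp C) *
        lin ((EuclideanSpace.proj i).comp C) + Λ (0, 0, 1) • (1 * 1) := by
    ext x
    have e1 : coneVec (C x) = (C x, 0, 0) + ‖C x‖ ^ 2 • (0, 1, 0) + (0, 0, 1) := by
      simp [coneVec]
    simp only [ContinuousMap.coe_mk, e1, map_add, map_smul,
      ContinuousMap.add_apply, ContinuousMap.mul_apply, ContinuousMap.smul_apply,
      ContinuousMap.one_apply, ContinuousMap.coe_sum, Finset.sum_apply, lin, smul_eq_mul, one_mul,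
      mul_one]
    rw [EuclideanSpace.real_norm_sq_eq, mul_comm (∑ i, _)]
    simp only [sq]
    rfl
  rw [e]
  refine add_mem (add_mem ?_ (Submodule.smul_mem _ _ (sum_mem fun i _ => ?_)))
    (Submodule.smul_mem _ _ ?_)
  · exact Submodule.mul_mem_mul one_mem_affineFunctions (linear_mem_affineFunctions _)
  · exact Submodule.mul_mem_mul (linear_mem_affineFunctions _) (linear_mem_affineFunctions _)
  · exact Submodule.mul_mem_mul one_mem_affineFunctions one_mem_affineFunctions

/-- The numerator of the rational map `x ↦ T (A x) - A' (T x)`. -/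
def defect (T : Lor d →L[ℝ] Lor d) (A A' : E d →L[ℝ] E d) (x : E d) : E d :=
  (T (coneVec x)).2.2 • (T (coneVec (A x))).1 - (T (coneVec (A x))).2.2 • A' (T (coneVec x)).1

theorem continuous_defect : Continuous
    fun q : ((Lor d →L[ℝ] Lor d) × (E d →L[ℝ] E d) × (E d →L[ℝ] E d)) × E d =>
      defect q.1.1 q.1.2.1 q.1.2.2 q.2 := by
  have := continuous_coneVec (d := d)
  unfold defect
  fun_prop

/-- The coordinates of `defect` as functions on the unit ball. -/
def defectMap (i : Fin d) :
    C((Lor d →L[ℝ] Lor d) × (E d →L[ℝ] E d) × (E d →L[ℝ] E d), C(UnitBall d, ℝ)) :=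
  ContinuousMap.curry ⟨fun q => defect q.1.1 q.1.2.1 q.1.2.2 q.2.1 i, by
    have h := (continuous_defect (d := d)).comp
      (continuous_fst.prodMk (continuous_subtype_val.comp continuous_snd) :
        Continuous fun q : ((Lor d →L[ℝ] Lor d) × (E d →L[ℝ] E d) × (E d →L[ℝ] E d)) × UnitBall d
          => (q.1, q.2.1))
    exact (EuclideanSpace.proj (𝕜 := ℝ) i).continuous.comp h⟩

theorem defectMap_apply (i : Fin d) (θ : (Lor d →L[ℝ] Lor d) × (E d →L[ℝ] E d) × (E d →L[ℝ] E d))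
    (x : UnitBall d) : defectMap i θ x = defect θ.1 θ.2.1 θ.2.2 x.1 i := rfl

/-- The quartic polynomial functions on the unit ball. -/
def quarticFunctions (d : ℕ) : Submodule ℝ C(UnitBall d, ℝ) :=
  affineFunctions d * affineFunctions d * (affineFunctions d * affineFunctions d)

instance : FiniteDimensional ℝ (quarticFunctions d) :=
  Module.Finite.iff_fg.2
    ((fg_affineFunctions.mul fg_affineFunctions).mul (fg_affineFunctions.mul fg_affineFunctions))

theorem defectMap_mem (i : Fin d)
    (θ : (Lor d →L[ℝ] Lor d) × (E d →L[ℝ] E d) × (E d →L[ℝ] E d)) :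
    defectMap i θ ∈ quarticFunctions d := by
  obtain ⟨T, A, A'⟩ := θ
  have hcv := continuous_coneVec (d := d)
  let quad (Λ : Lor d →L[ℝ] ℝ) (C : E d →L[ℝ] E d) : C(UnitBall d, ℝ) :=
    ⟨fun x : UnitBall d => Λ (coneVec (C x)), by fun_prop⟩
  let last : Lor d →L[ℝ] ℝ :=
    (ContinuousLinearMap.snd ℝ ℝ ℝ).comp ((ContinuousLinearMap.snd ℝ (E d) (ℝ × ℝ)).comp T)
  let first : Lor d →L[ℝ] E d := (ContinuousLinearMap.fst ℝ (E d) (ℝ × ℝ)).comp T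
  have e : defectMap i (T, A, A') =
      quad last (ContinuousLinearMap.id ℝ _) * quad ((EuclideanSpace.proj i).comp first) A -
      quad last A * quad ((EuclideanSpace.proj i).comp (A'.comp first))
        (ContinuousLinearMap.id ℝ _) := by
    ext x
    rfl
  rw [e]
  exact sub_mem (Submodule.mul_mem_mul (quadratic_mem _ _ _) (quadratic_mem _ _ _))
    (Submodule.mul_mem_mul (quadratic_mem _ _ _) (quadratic_mem _ _ _))

theorem defect_one (B : E d →L[ℝ] E d) (x : E d) : defect 1 B B x = 0 := by
  simp [defect, coneVec]

theorem defect_zero_ne {T : Lor d →L[ℝ] Lor d} {φ : Bdry d ≃ₜ Bdry d} (h : Induces T φ)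
    (A : E d →L[ℝ] E d) {A' : E d →L[ℝ] E d} (hA' : ‖A'‖ < 1)
    (h0 : φ ((0 : E d) : Bdry d) ≠ ((0 : E d) : Bdry d)) (hinf : φ ((0 : E d) : Bdry d) ≠ ∞) :
    defect T A A' 0 ≠ 0 := by
  intro he
  have hq := h.snd_snd_ne_zero hinf
  rw [defect, map_zero, ← smul_sub, smul_eq_zero_iff_right hq, sub_eq_zero] at he
  have hP : (T (coneVec 0)).1 = 0 := by
    by_contra hne
    have h1 := A'.le_opNorm (T (coneVec 0)).1
    rw [← he] at h1
    have h2 := norm_pos_iff.2 hne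
    nlinarith
  exact h0 (by rw [h.apply_coe hq, hP, smul_zero])

theorem exists_subseq_normalized {X : Type*} [NormedAddCommGroup X] [NormedSpace ℝ X]
    [FiniteDimensional ℝ X] {f : ℕ → X} (hf : Tendsto f atTop (𝓝 0)) (hne : ∀ k, f k ≠ 0) :
    ∃ κ : ℕ → ℕ, StrictMono κ ∧ ∃ (δ : ℕ → ℝ) (u : X), (∀ k, 0 < δ k) ∧
      Tendsto δ atTop (𝓝 0) ∧ u ≠ 0 ∧ Tendsto (fun k => (δ k)⁻¹ • f (κ k)) atTop (𝓝 u) := by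
  have : ProperSpace X := FiniteDimensional.proper_real _
  obtain ⟨u, hu, κ, hκ, hlim⟩ := (isCompact_sphere (0 : X) 1).tendsto_subseq
    (x := fun k => ‖f k‖⁻¹ • f k) (fun k => by
      rw [mem_sphere_zero_iff_norm, norm_smul, norm_inv, norm_norm,
        inv_mul_cancel₀ (norm_ne_zero_iff.2 (hne k))])
  refine ⟨κ, hκ, fun k => ‖f (κ k)‖, u, fun k => norm_pos_iff.2 (hne _), ?_, ?_, hlim⟩
  · simpa using (hf.comp hκ.tendsto_atTop).norm
  · rintro rfl
    simp at hu

theorem exists_subseq_defect {θ : ℕ → (Lor d →L[ℝ] Lor d) × (E d →L[ℝ] E d) × (E d →L[ℝ] E d)}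
    {B : E d →L[ℝ] E d} (hθ : Tendsto θ atTop (𝓝 (1, B, B)))
    (hne : ∀ k, defect (θ k).1 (θ k).2.1 (θ k).2.2 0 ≠ 0) :
    ∃ κ : ℕ → ℕ, StrictMono κ ∧ ∃ (δ : ℕ → ℝ) (p Y : E d), (∀ k, 0 < δ k) ∧
      Tendsto δ atTop (𝓝 0) ∧ Y ≠ 0 ∧
      Tendsto (fun q : ℕ × E d => (δ q.1)⁻¹ •
        defect (θ (κ q.1)).1 (θ (κ q.1)).2.1 (θ (κ q.1)).2.2 q.2) (atTop ×ˢ 𝓝 p) (𝓝 Y) := by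
  let f : ℕ → Fin d → quarticFunctions d := fun k i => ⟨defectMap i (θ k), defectMap_mem i (θ k)⟩
  have hf : ∀ k i (x : UnitBall d),
      (f k i : C(UnitBall d, ℝ)) x = defect (θ k).1 (θ k).2.1 (θ k).2.2 x.1 i := fun _ _ _ => rfl
  have hf0 : Tendsto f atTop (𝓝 0) := by
    rw [tendsto_pi_nhds]
    intro i
    rw [tendsto_subtype_rng]
    have h1 := ((defectMap i).continuous.tendsto _).comp hθ
    have h2 : defectMap i ((1, B, B) : (Lor d →L[ℝ] Lor d) × (E d →L[ℝ] E d) × (E d →L[ℝ] E d)) =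
        0 := by
      ext x
      rw [defectMap_apply, defect_one]
      rfl
    rw [h2] at h1
    exact h1
  have hfne : ∀ k, f k ≠ 0 := by
    intro k h
    refine hne k ?_
    ext i
    rw [← hf k i ⟨0, by simp⟩, h]
    rfl
  obtain ⟨κ, hκ, δ, u, hδ, hδ0, hu0, hlim⟩ := exists_subseq_normalized hf0 hfne
  obtain ⟨i, hi⟩ := Function.ne_iff.1 hu0
  obtain ⟨x, hx⟩ : ∃ x : UnitBall d, (u i : C(UnitBall d, ℝ)) x ≠ 0 := by
    by_contra! h
    exact hi (Subtype.ext (ContinuousMap.ext h))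
  obtain ⟨p, hp, hpu⟩ : ∃ p : UnitBall d, ‖p.1‖ < 1 ∧ (u i : C(UnitBall d, ℝ)) p ≠ 0 := by
    have hopen : IsOpen {y : UnitBall d | (u i : C(UnitBall d, ℝ)) y ≠ 0} :=
      isOpen_ne_fun (u i : C(UnitBall d, ℝ)).continuous continuous_const
    obtain ⟨U, hU, hUe⟩ := isOpen_induced_iff.1 hopen
    have hxU : x.1 ∈ U := by
      have : x ∈ Subtype.val ⁻¹' U := by rw [hUe]; exact hx
      exact this
    have hxc : x.1 ∈ closure (Metric.ball (0 : E d) 1) := by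
      rw [closure_ball _ one_ne_zero]; exact x.2
    obtain ⟨y, hyU, hy⟩ := mem_closure_iff.1 hxc U hU hxU
    refine ⟨⟨y, Metric.ball_subset_closedBall hy⟩, mem_ball_zero_iff.1 hy, ?_⟩
    have : (⟨y, Metric.ball_subset_closedBall hy⟩ : UnitBall d) ∈ Subtype.val ⁻¹' U := hyU
    rw [hUe] at this
    exact this
  let Y : E d := WithLp.toLp 2 fun j => (u j : C(UnitBall d, ℝ)) p
  refine ⟨κ, hκ, δ, p, Y, hδ, hδ0, ?_, ?_⟩
  · intro h
    exact hpu (congrArg (fun y : E d => y i) h)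
  · have hball : Metric.closedBall (0 : E d) 1 ∈ 𝓝 p.1 :=
      Metric.closedBall_mem_nhds_of_mem (mem_ball_zero_iff.2 hp)
    rw [← map_nhds_subtype_coe_eq_nhds p.2 hball, ← Filter.map_id (f := atTop),
      Filter.prod_map_map_eq, tendsto_map'_iff]
    have hcoord : ∀ j, Tendsto (fun q : ℕ × UnitBall d =>
        (((δ q.1)⁻¹ • f (κ q.1)) j : C(UnitBall d, ℝ)) q.2) (atTop ×ˢ 𝓝 p)
        (𝓝 ((u j : C(UnitBall d, ℝ)) p)) := by
      intro j
      have h1 : Tendsto (fun k => (((δ k)⁻¹ • f (κ k)) j : C(UnitBall d, ℝ))) atTop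
          (𝓝 (u j)) := (continuous_subtype_val.tendsto _).comp (tendsto_pi_nhds.1 hlim j)
      have h2 : Tendsto (fun q : C(UnitBall d, ℝ) × UnitBall d => q.1 q.2)
          (𝓝 ((u j : C(UnitBall d, ℝ)), p)) (𝓝 ((u j : C(UnitBall d, ℝ)) p)) :=
        (ContinuousEval.continuous_eval (F := C(UnitBall d, ℝ))).tendsto _
      exact h2.comp ((h1.comp tendsto_fst).prodMk_nhds tendsto_snd)
    refine (((PiLp.continuous_toLp 2 _).tendsto _).comp (tendsto_pi_nhds.2 hcoord)).congr ?_
    intro q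
    ext j
    rfl

theorem exists_displacement {T : ℕ → Lor d →L[ℝ] Lor d} {φ : ℕ → (Bdry d ≃ₜ Bdry d)}
    (hT : Tendsto T atTop (𝓝 1)) (hφ : ∀ k, Induces (T k) (φ k)) (hφ1 : Tendsto φ atTop (𝓝 1))
    {A A' : ℕ → (E d ≃L[ℝ] E d)} {B : E d ≃L[ℝ] E d}
    (hA : Tendsto (fun k => (A k : E d →L[ℝ] E d)) atTop (𝓝 (B : E d →L[ℝ] E d)))
    (hA' : Tendsto (fun k => (A' k : E d →L[ℝ] E d)) atTop (𝓝 (B : E d →L[ℝ] E d)))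
    (hA'1 : ∀ k, ‖(A' k : E d →L[ℝ] E d)‖ < 1)
    (h0 : ∀ k, φ k ((0 : E d) : Bdry d) ≠ ((0 : E d) : Bdry d))
    (hinf : ∀ k, φ k ((0 : E d) : Bdry d) ≠ ∞) :
    ∃ κ : ℕ → ℕ, StrictMono κ ∧ ∃ (δ : ℕ → ℝ) (p v : E d) (w : ℕ → E d → E d), (∀ k, 0 < δ k) ∧
      Tendsto δ atTop (𝓝 0) ∧ v ≠ 0 ∧
      Tendsto (fun q : ℕ × E d => w q.1 q.2) (atTop ×ˢ 𝓝 p) (𝓝 v) ∧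
      ∀ᶠ q : ℕ × E d in atTop ×ˢ 𝓝 p,
        ((linExt (A' (κ q.1)))⁻¹ * φ (κ q.1) * linExt (A (κ q.1)) * (φ (κ q.1))⁻¹)
          (q.2 : Bdry d) = ((q.2 + δ q.1 • w q.1 q.2 : E d) : Bdry d) := by
  obtain ⟨κ, hκ, δ, p, Y, hδ, hδ0, hY, hlim⟩ := exists_subseq_defect
    (hT.prodMk_nhds (hA.prodMk_nhds hA'))
    (fun k => defect_zero_ne (hφ k) _ (hA'1 k) (h0 k) (hinf k))
  have hκt := hκ.tendsto_atTop
  -- the preimage `x` of `y`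
  let x : ℕ × E d → E d := fun q => finPart ((φ (κ q.1))⁻¹ (q.2 : Bdry d))
  have hinv : Tendsto (fun q : ℕ × E d => (φ (κ q.1))⁻¹ (q.2 : Bdry d)) (atTop ×ˢ 𝓝 p)
      (𝓝 (p : Bdry d)) := by
    have h1 := tendsto_homeo_iff.1 (homeo_tendsto_inv (hφ1.comp hκt)) (p : Bdry d)
    rw [inv_one] at h1
    exact h1.comp (tendsto_fst.prodMk ((OnePoint.continuous_coe.tendsto p).comp tendsto_snd))
  have hx : Tendsto x (atTop ×ˢ 𝓝 p) (𝓝 p) := (tendsto_finPart p).comp hinv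
  have hxx : Tendsto (fun q => (q.1, x q)) (atTop ×ˢ 𝓝 p) (atTop ×ˢ 𝓝 p) :=
    tendsto_fst.prodMk hx
  have hden : ∀ {y : ℕ × E d → E d} {y₀ : E d}, Tendsto y (atTop ×ˢ 𝓝 p) (𝓝 y₀) →
      Tendsto (fun q => (T (κ q.1) (coneVec (y q))).2.2) (atTop ×ˢ 𝓝 p) (𝓝 1) := by
    intro y y₀ hy
    have h1 : Tendsto (fun q : ℕ × E d => T (κ q.1) (coneVec (y q))) (atTop ×ˢ 𝓝 p)
        (𝓝 ((1 : Lor d →L[ℝ] Lor d) (coneVec y₀))) :=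
      (isBoundedBilinearMap_apply.continuous.tendsto ((1 : Lor d →L[ℝ] Lor d), coneVec y₀)).comp
        (((hT.comp hκt).comp tendsto_fst).prodMk_nhds ((continuous_coneVec.tendsto _).comp hy))
    exact (((continuous_snd.comp continuous_snd).tendsto _).comp h1)
  have hAx : Tendsto (fun q => A (κ q.1) (x q)) (atTop ×ˢ 𝓝 p) (𝓝 (B p)) :=
    (isBoundedBilinearMap_apply.continuous.tendsto ((B : E d →L[ℝ] E d), p)).comp
      (((hA.comp hκt).comp tendsto_fst).prodMk_nhds hx)
  have hq1 := hden hx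
  have hq2 := hden hAx
  let w : ℕ → E d → E d := fun k y =>
    ((T (κ k) (coneVec (x (k, y)))).2.2 * (T (κ k) (coneVec (A (κ k) (x (k, y))))).2.2)⁻¹ •
      (A' (κ k)).symm ((δ k)⁻¹ • defect (T (κ k)) (A (κ k)) (A' (κ k)) (x (k, y)))
  refine ⟨κ, hκ, δ, p, B.symm Y, w, hδ, hδ0, ?_, ?_, ?_⟩
  · rwa [Ne, ContinuousLinearEquiv.map_eq_zero_iff]
  · have h1 := (hq1.mul hq2).inv₀ (by norm_num)
    have h2 : Tendsto (fun q : ℕ × E d => (A' (κ q.1)).symm ((δ q.1)⁻¹ •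
        defect (T (κ q.1)) (A (κ q.1)) (A' (κ q.1)) (x q))) (atTop ×ˢ 𝓝 p) (𝓝 (B.symm Y)) :=
      (isBoundedBilinearMap_apply.continuous.tendsto ((B.symm : E d →L[ℝ] E d), Y)).comp
        ((((tendsto_symm_of_tendsto hA').comp hκt).comp tendsto_fst).prodMk_nhds (hlim.comp hxx))
    rw [mul_one, inv_one] at h1
    simpa only [one_smul] using h1.smul h2
  · filter_upwards [hinv.eventually (eventually_eq_finPart p), hq1.eventually_ne one_ne_zero,
      hq2.eventually_ne one_ne_zero] with q hfin hne1 hne2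
    obtain ⟨k, y⟩ := q
    have hyx : (φ (κ k))⁻¹ (y : Bdry d) = ((x (k, y) : E d) : Bdry d) := hfin
    have hy : (y : Bdry d) = φ (κ k) ((x (k, y) : E d) : Bdry d) := by
      rw [← hyx]; exact ((φ (κ k)).apply_symm_apply _).symm
    rw [(hφ (κ k)).apply_coe hne1, OnePoint.coe_eq_coe] at hy
    simp only [Homeomorph.mul_apply, hyx, linExt_coe, w]
    rw [(hφ (κ k)).apply_coe hne2, linExt_inv_coe, OnePoint.coe_eq_coe,
      ContinuousLinearEquiv.symm_apply_eq]
    simp only [map_add, map_smul, ContinuousLinearEquiv.apply_symm_apply]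
    rw [smul_comm (δ k), smul_smul (δ k), mul_inv_cancel₀ (hδ k).ne', one_smul]
    nth_rw 3 [hy]
    rw [defect, map_smul]
    simp only at hne1 hne2
    rw [ContinuousLinearEquiv.coe_coe, ContinuousLinearEquiv.coe_coe]
    match_scalars
    · field_simp
    · field_simp
      ring

/-- After precomposition with a dilation, the base point is moved an amount bounded in terms of the
images of `0` and `∞`. -/
theorem exists_balanced {g : Equiv.Perm (HypSpace d)} (hg : g ∈ hypIsom d) {S : Bdry d ≃ₜ Bdry d}
    (hS : IsBoundaryMap g S) : ∃ (s : ℝ) (hs : 0 < s),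
      lorMass (hypPt ((g * similarity 0 hs : Equiv.Perm (HypSpace d)) (basePt d))) =
        2 / √(lor (bdryRay (S ((0 : E d) : Bdry d))) (bdryRay (S ∞))) := by
  obtain ⟨T, hT⟩ := exists_represents hg
  have hI := hS.induces hg hT
  obtain ⟨hα, eα⟩ := hI ((0 : E d) : Bdry d)
  obtain ⟨hβ, eβ⟩ := hI ∞
  set α := lorMass (T (bdryRay ((0 : E d) : Bdry d))) with hαd
  set β := lorMass (T (bdryRay (∞ : Bdry d))) with hβd
  set L := lor (bdryRay (S ((0 : E d) : Bdry d))) (bdryRay (S ∞)) with hL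
  have hprod : α * (β * L) = 1 := by
    have h1 := hT.lor_eq hg (bdryRay ((0 : E d) : Bdry d)) (bdryRay ∞)
    rw [eα, eβ, map_smul, map_smul, LinearMap.smul_apply, smul_eq_mul, smul_eq_mul, ← hL] at h1
    have h2 : lor (bdryRay ((0 : E d) : Bdry d)) (bdryRay ∞) = 1 := by
      rw [bdryRay_coe, bdryRay_infty, lor_apply]; simp
    rw [h2] at h1
    linarith
  have hLeq : L = (α * β)⁻¹ := by
    refine eq_inv_of_mul_eq_one_left ?_
    linarith
  have hs : 0 < √α / √β := div_pos (Real.sqrt_pos.2 hα) (Real.sqrt_pos.2 hβ)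
  refine ⟨√α / √β, hs, ?_⟩
  have hbase : hypPt (similarity 0 hs (basePt d)) =
      (√α / √β) • bdryRay (∞ : Bdry d) + (√α / √β)⁻¹ • bdryRay ((0 : E d) : Bdry d) := by
    have hs' := hs.ne'
    rw [bdryRay_coe, bdryRay_infty]
    ext1
    · simp [hypPt, similarity, mkPt, basePt]
    · ext1
      · simp [hypPt, similarity, mkPt, basePt, sq]
      · simp [hypPt, similarity, mkPt, basePt]
  have h3 : lorMass (hypPt ((g * similarity 0 hs : Equiv.Perm (HypSpace d)) (basePt d))) =
      (√α / √β) * β + (√α / √β)⁻¹ * α := by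
    rw [Equiv.Perm.mul_apply, ← hT, hbase, map_add, map_smul, map_smul, map_add, map_smul,
      map_smul, smul_eq_mul, smul_eq_mul]
  rw [h3, hLeq, Real.sqrt_inv, Real.sqrt_mul hα.le]
  have hα' := Real.sqrt_pos.2 hα
  have hβ' := Real.sqrt_pos.2 hβ
  have e1 : √α / √β * β = √α * √β := by
    rw [div_mul_eq_mul_div, div_eq_iff hβ'.ne', mul_assoc, Real.mul_self_sqrt hβ.le]
  have e2 : (√α / √β)⁻¹ * α = √α * √β := by
    rw [inv_div, div_mul_eq_mul_div, div_eq_iff hα'.ne', mul_right_comm, Real.mul_self_sqrt hα.le,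
      mul_comm]
  rw [e1, e2, div_inv_eq_mul]
  ring

theorem IsBasedLinearMap.exists_balanced {ε M : Bdry d} {A : E d ≃L[ℝ] E d} {f : Bdry d ≃ₜ Bdry d}
    (h : IsBasedLinearMap ε M A f) : ∃ (g : Equiv.Perm (HypSpace d)) (S : Bdry d ≃ₜ Bdry d),
      g ∈ hypIsom d ∧ IsBoundaryMap g S ∧ S ((0 : E d) : Bdry d) = ε ∧
      f = S * linExt A * S⁻¹ ∧
      lorMass (hypPt (g (basePt d))) = 2 / √(lor (bdryRay ε) (bdryRay M)) := by
  obtain ⟨S, ⟨g, hg, hS⟩, h0, hinf, -, rfl⟩ := h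
  obtain ⟨s, hs, he⟩ := KleinianFlow.exists_balanced hg hS
  refine ⟨g * similarity 0 hs, S * bdrySimilarity 0 hs, mul_mem hg (similarity_mem _ hs),
    hS.mul (isBoundaryMap_similarity _ hs) hg (similarity_mem _ hs), ?_, ?_, by rw [he, h0, hinf]⟩
  · rw [Homeomorph.mul_apply, bdrySimilarity_coe, smul_zero, add_zero, h0]
  · rw [mul_inv_rev, mul_assoc S (bdrySimilarity 0 hs), ← linExt_mul_bdrySimilarity]
    group

theorem exists_injective_comp {α : Type*} {ε : ℕ → α} (h : (Set.range ε).Infinite) :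
    ∃ a : ℕ → ℕ, Tendsto a atTop atTop ∧ Function.Injective (fun k => ε (a k)) := by
  choose a ha using fun k => (h.natEmbedding _ k).2
  have hinj : Function.Injective fun k => ε (a k) := by
    intro i j hij
    simp only [ha] at hij
    exact (h.natEmbedding _).injective (Subtype.ext hij)
  refine ⟨a, ?_, hinj⟩
  have : Function.Injective a := fun i j hij => hinj (by simp only [hij])
  rw [← Nat.cofinite_eq_atTop]
  exact this.tendsto_cofinite

/-- Conjugates by `Ψ` of all translations along `v` form a one-parameter subgroup. -/
theorem containsOneParameterSubgroup_of_translation {H : Subgroup (Bdry d ≃ₜ Bdry d)}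
    (Ψ : Bdry d ≃ₜ Bdry d) {v : E d} (hv : v ≠ 0)
    (h : ∀ t : ℝ, 0 ≤ t → Ψ * translation (t • v) * Ψ⁻¹ ∈ closure (H : Set (Bdry d ≃ₜ Bdry d))) :
    ContainsOneParameterSubgroup (closure (H : Set (Bdry d ≃ₜ Bdry d))) := by
  refine ⟨fun t => Ψ * translation (t • v) * Ψ⁻¹, ?_, fun s t => ?_, ⟨1, fun h1 => ?_⟩, fun t => ?_⟩
  · exact (continuous_const.mul (continuous_translation.comp (by fun_prop))).mul continuous_const
  · simp only [add_smul, translation_add]; group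
  · rw [mul_inv_eq_one, mul_eq_left, one_smul] at h1
    have h2 := DFunLike.congr_fun h1 ((0 : E d) : Bdry d)
    rw [translation_coe, zero_add, Homeomorph.one_apply, OnePoint.coe_eq_coe] at h2
    exact hv h2
  · rcases le_total 0 t with ht | ht
    · exact h t ht
    · have h1 := H.topologicalClosure.inv_mem (h (-t) (neg_nonneg.2 ht))
      have e : (Ψ * translation (-t • v) * Ψ⁻¹)⁻¹ = Ψ * translation (t • v) * Ψ⁻¹ := by
        rw [neg_smul, translation_neg]; group
      rw [e] at h1
      exact h1

theorem containsOneParameterSubgroup_of_basedLinearMaps {d : ℕ}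
    {G : Subgroup (Equiv.Perm (HypSpace d))} (hG : IsCocompactKleinian G)
    {F : ℕ → (Bdry d ≃ₜ Bdry d)} {ε M : ℕ → Bdry d} {A : ℕ → (E d ≃L[ℝ] E d)}
    (hF : ∀ n, IsBasedLinearMap (ε n) (M n) (A n) (F n)) (hεinf : (Set.range ε).Infinite)
    {ε' M' : Bdry d} (hne : ε' ≠ M') (hε : Tendsto ε atTop (𝓝 ε')) (hM : Tendsto M atTop (𝓝 M'))
    {B : E d ≃L[ℝ] E d}
    (hA : Tendsto (fun n => (A n : E d →L[ℝ] E d)) atTop (𝓝 (B : E d →L[ℝ] E d)))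
    (hB : ‖(B : E d →L[ℝ] E d)‖ < 1) :
    ContainsOneParameterSubgroup (closure (Subgroup.closure (boundaryMaps G ∪ Set.range F) :
      Set (Bdry d ≃ₜ Bdry d))) := by
  obtain ⟨a, ha, hainj⟩ := exists_injective_comp hεinf
  choose g S hg hS hS0 hFS hmass using fun n => (hF n).exists_balanced
  choose T T' _ hT hT' _ _ _ using fun n => exists_model (hg n)
  obtain ⟨c, hc⟩ : ∃ c, ∀ k, lorMass (hypPt (g (a k) (basePt d))) ≤ c := by
    have h1 : Tendsto (fun q : Lor d × Lor d => lor q.1 q.2) (𝓝 (bdryRay ε', bdryRay M'))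
        (𝓝 (lor (bdryRay ε') (bdryRay M'))) := by
      have : Continuous fun q : Lor d × Lor d => lor q.1 q.2 := by
        simp only [lor_apply]; fun_prop
      exact this.tendsto _
    have h2 := h1.comp (((continuous_bdryRay.tendsto _).comp (hε.comp ha)).prodMk_nhds
      ((continuous_bdryRay.tendsto _).comp (hM.comp ha)))
    have h3 := ((tendsto_const_nhds (x := (2 : ℝ))).div h2.sqrt
      (Real.sqrt_pos.2 (lor_bdryRay_pos hne)).ne').bddAbove_range
    obtain ⟨c, hc⟩ := h3
    exact ⟨c, fun k => by rw [hmass]; exact hc ⟨k, rfl⟩⟩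
  obtain ⟨κ, hκ, R, R', -, hR, hR', -, hRR, -⟩ := exists_subseq_tendsto
    (fun k => hg (a k)) (fun k => hT (a k)) (fun k => hT' (a k)) (fun k => hS (a k)) hc
  let b : ℕ → ℕ := fun k => a (κ k)
  have hb : Tendsto b atTop atTop := ha.comp hκ.tendsto_atTop
  have hb1 : Tendsto (fun k => b (k + 1)) atTop atTop := hb.comp (tendsto_add_atTop_nat 1)
  let ρ : ℕ → (Bdry d ≃ₜ Bdry d) := fun k => (S (b (k + 1)))⁻¹ * S (b k)
  have hρT : Tendsto (fun k => T' (b (k + 1)) * T (b k)) atTop (𝓝 1) := by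
    rw [← hRR]
    exact (hR'.comp (tendsto_add_atTop_nat 1)).mul hR
  have hρI : ∀ k, Induces (T' (b (k + 1)) * T (b k)) (ρ k) := fun k =>
    (((hS _).inv (hg _)).induces (inv_mem (hg _)) (hT' _)).mul ((hS _).induces (hg _) (hT _))
  have hone : Induces (1 : Lor d →L[ℝ] Lor d) (1 : Bdry d ≃ₜ Bdry d) := fun ξ => by
    simp [lorMass_bdryRay]
  have hρ1 : Tendsto ρ atTop (𝓝 1) := tendsto_of_induces hρT hρI hone
  have hρ0 : ∀ k, ρ k ((0 : E d) : Bdry d) ≠ ((0 : E d) : Bdry d) := by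
    intro k h
    have h1 : S (b (k + 1)) (ρ k ((0 : E d) : Bdry d)) = S (b k) ((0 : E d) : Bdry d) :=
      (S (b (k + 1))).apply_symm_apply _
    rw [h, hS0, hS0] at h1
    have h2 := hκ.injective (hainj h1)
    omega
  have hev1 : ∀ᶠ k in atTop, ρ k ((0 : E d) : Bdry d) ≠ ∞ := by
    have h1 : Tendsto (fun k => ρ k ((0 : E d) : Bdry d)) atTop (𝓝 ((0 : E d) : Bdry d)) :=
      homeo_tendsto_apply hρ1 _
    exact h1.eventually_ne (OnePoint.coe_ne_infty _)
  have hev2 : ∀ᶠ k in atTop, ‖(A (b (k + 1)) : E d →L[ℝ] E d)‖ < 1 :=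
    (hA.comp hb1).norm.eventually_lt_const hB
  obtain ⟨θ, hθ, hθP⟩ := extraction_of_eventually_atTop (hev1.and hev2)
  have hθt := hθ.tendsto_atTop
  obtain ⟨κ', hκ', δ, p, v, w, hδ, hδ0, hv, hw, hh⟩ := exists_displacement
    (hρT.comp hθt) (fun k => hρI (θ k)) (hρ1.comp hθt)
    (A := fun k => A (b (θ k))) (A' := fun k => A (b (θ k + 1)))
    (hA.comp (hb.comp hθt)) (hA.comp (hb1.comp hθt)) (fun k => (hθP k).2)
    (fun k => hρ0 (θ k)) (fun k => (hθP k).1)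
  let m : ℕ → ℕ := fun k => θ (κ' k)
  have hm : Tendsto m atTop atTop := hθt.comp hκ'.tendsto_atTop
  let h : ℕ → (Bdry d ≃ₜ Bdry d) := fun k =>
    (linExt (A (b (m k + 1))))⁻¹ * ρ (m k) * linExt (A (b (m k))) * (ρ (m k))⁻¹
  have hlim : Tendsto h atTop (𝓝 1) := by
    have h1 := hρ1.comp hm
    have h2 := (((tendsto_linExt (hA.comp (hb1.comp hm))).inv.mul h1).mul
      (tendsto_linExt (hA.comp (hb.comp hm)))).mul h1.inv
    simpa using h2
  have hFh : ∀ k, (F (b (m k + 1)))⁻¹ * F (b (m k)) =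
      S (b (m k + 1)) * h k * (S (b (m k + 1)))⁻¹ := by
    intro k
    simp only [hFS, h, ρ]
    group
  let s : ℕ → ℝ := fun k => √(δ k)
  have hs : ∀ k, 0 < s k := fun k => Real.sqrt_pos.2 (hδ k)
  have hs0 : Tendsto s atTop (𝓝 0) := by simpa using hδ0.sqrt
  have hh' : ∀ᶠ q : ℕ × E d in atTop ×ˢ 𝓝 p,
      h q.1 (q.2 : Bdry d) = ((q.2 + s q.1 ^ 2 • w q.1 q.2 : E d) : Bdry d) := by
    filter_upwards [hh] with q hq
    rw [Real.sq_sqrt (hδ q.1).le]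
    exact hq
  obtain ⟨ν, hν, Γ, Ψ, hΓ, hΨ⟩ := exists_subseq_boundaryMaps hG
    (g := fun k => g (b (m k + 1)) * similarity p (hs k))
    (fun k => mul_mem (hg _) (similarity_mem _ _))
    (fun k => (hS (b (m k + 1))).mul (isBoundaryMap_similarity p (hs k)) (hg _)
      (similarity_mem _ _))
  refine containsOneParameterSubgroup_of_translation Ψ hv fun t ht => ?_
  have h1 := (tendsto_translation hs hs0 hlim hw hh' ht).comp hν.tendsto_atTop
  refine mem_closure_of_tendsto ((hΨ.mul h1).mul hΨ.inv) (Eventually.of_forall fun k => ?_)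
  have hFmem : ∀ n, F n ∈ Subgroup.closure (boundaryMaps G ∪ Set.range F) := fun n =>
    Subgroup.subset_closure (Or.inr ⟨n, rfl⟩)
  have hΓmem : Γ k ∈ Subgroup.closure (boundaryMaps G ∪ Set.range F) :=
    Subgroup.subset_closure (Or.inl (hΓ k))
  have key : (Γ k * (S (b (m (ν k) + 1)) * bdrySimilarity p (hs (ν k)))) *
      ((bdrySimilarity p (hs (ν k)))⁻¹ * h (ν k) * bdrySimilarity p (hs (ν k))) ^
        ⌊t / s (ν k)⌋₊ * (Γ k * (S (b (m (ν k) + 1)) * bdrySimilarity p (hs (ν k))))⁻¹ =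
      (Γ k * ((F (b (m (ν k) + 1)))⁻¹ * F (b (m (ν k)))) * (Γ k)⁻¹) ^ ⌊t / s (ν k)⌋₊ := by
    rw [← conj_pow, hFh]
    congr 1
    group
  simp only [Function.comp_apply, key]
  exact pow_mem (mul_mem (mul_mem hΓmem (mul_mem (inv_mem (hFmem _)) (hFmem _)))
    (inv_mem hΓmem)) _

end KleinianFlow

end

theorem proposition3p3 (d : ℕ) (hd : 1 ≤ d)
    (G : Subgroup (Equiv.Perm (KleinianFlow.HypSpace d)))
    (hG : KleinianFlow.IsCocompactKleinian G)
    (F : ℕ → (KleinianFlow.Bdry d ≃ₜ KleinianFlow.Bdry d))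
    (ε M : ℕ → KleinianFlow.Bdry d)
    (A : ℕ → (KleinianFlow.E d ≃L[ℝ] KleinianFlow.E d))
    (hF : ∀ n, KleinianFlow.IsBasedLinearMap (ε n) (M n) (A n) (F n))
    (hεinf : (Set.range ε).Infinite) (hMinf : (Set.range M).Infinite)
    (ε' M' : KleinianFlow.Bdry d) (hne : ε' ≠ M')
    (hε : Tendsto ε atTop (𝓝 ε')) (hM : Tendsto M atTop (𝓝 M'))
    (B : KleinianFlow.E d ≃L[ℝ] KleinianFlow.E d)
    (hA : Tendsto (fun n => (A n : KleinianFlow.E d →L[ℝ] KleinianFlow.E d)) atTop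
      (𝓝 (B : KleinianFlow.E d →L[ℝ] KleinianFlow.E d)))
    (hB : ‖(B : KleinianFlow.E d →L[ℝ] KleinianFlow.E d)‖ < 1) :
    KleinianFlow.ContainsOneParameterSubgroup
      (closure (Subgroup.closure (KleinianFlow.boundaryMaps G ∪ Set.range F) :
        Set (KleinianFlow.Bdry d ≃ₜ KleinianFlow.Bdry d))) := by
  exact KleinianFlow.containsOneParameterSubgroup_of_basedLinearMaps hG hF hεinf hne hε hM hA hB
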